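/- **Setting.** Let $E$ be a measurable space, $n\ge 1$, and $\mu_1,\dots,\mu_n$ probability measures on $E$. A Markov semigroup with stationary distribution $\pi$ is a family $(P^t)_{t\ge0}$ of Markov kernels on $E$ with $P^0=\mathrm{id}$, $P^{s+t}=P^sP^t$, $\pi P^t=\pi$, and $P^tf\to f$ in $L^2(\pi)$ as $t\downarrow0$ for all $f\in L^2(\pi)$. Its generator is $\mathscr L f=\lim_{t\downarrow0}(P^tf-f)/t$ in $L^2(\pi)$, and its Dirichlet form is $\mathscr E(f,f)=-\langle f,\mathscr Lf\rangle_\pi$, extended to all $f\in L^2(\pi)$ by $\mathscr E(f,f)=\liminf_{t\downarrow0}\tfrac1t\langle f,f-P^tf\rangle_\pi\in[0,\infty]$; the domain of the form is the set of $f$ with $\mathscr E(f,f)<\infty$. We write $\mathrm{Ent}_\pi(h)=\pi(h\log h)-\pi(h)\log\pi(h)$. **Assumptions.** For every $1\le k\le n$ let $(P_k^t)_{t\ge0}$ be a Markov semigroup, reversible with respect to its stationary distribution $\mu_k$, with generator $\mathscr L_k$ and Dirichlet form $\mathscr E_k$. Assume: 1. $\mu_k=\sum_{i=1}^{M_k}w_k^{(i)}\mu_k^{(i)}$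 with probability measures $\mu_k^{(i)}$ and weights $w_k^{(i)}>0$, $\sum_{i=1}^{M_k}w_k^{(i)}=1$. 2. For every $1\le k<n$, $\mu_{k+1}$ has a (finite) density $\bar g_{k,k+1}=\frac{d\mu_{k+1}}{d\mu_k}$ with respect to $\mu_k$, and $\bar g_{k,k+1}\le\gamma$ $\mu_k$-a.e., with $\gamma$ not depending on $k$. 3. For every $k$ and $i$ there is a Markov semigroup $P_{ki}$ with stationary distribution $\mu_k^{(i)}$, generator $\mathscr L_{ki}$ and Dirichlet form $\mathscr E_{ki}$, such that $\langle f,\mathscr L_kf\rangle_{\mu_k}\le\sum_{i=1}^{M_k}w_k^{(i)}\langle f,\mathscr L_{ki}f\rangle_{\mu_k^{(i)}}$, that is, $\sum_{i=1}^{M_k}w_k^{(i)}\mathscr E_{ki}(f,f)\le\mathscr E_k(f,f)$ for all $f\in L^2(\mu_k)$. 4. There are constants $c_{ki}$ such that $\mathrm{Ent}_{\mu_k^{(i)}}(f^2)\le c_{ki}\,\mathscr E_{ki}(f,f)$ for all $f$ in the domain of $\mathscr E_{ki}$ (in particular the entropy is finite). Put $C_k^*=\max_ic_{ki}$, $M=\max_kM_k$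 and $w^*=\min_{k,i}w_k^{(i)}$. **Algorithm.** Sequential Monte Carlo (SMC) with $N$ particles and times $t_k\ge0$: draw $\xi_1^{(1)},\dots,\xi_1^{(N)}$ independently from $\mu_1$. For $k=1,\dots,n-1$, given $\xi_k^{(1)},\dots,\xi_k^{(N)}$, draw $\hat\xi_{k+1}^{(1)},\dots,\hat\xi_{k+1}^{(N)}$ independently from $\sum_{j=1}^NW_j\,\delta_{\xi_k^{(j)}}$, where $W_j=\bar g_{k,k+1}(\xi_k^{(j)})/\sum_{l=1}^N\bar g_{k,k+1}(\xi_k^{(l)})$ (and $W_j=1/N$ if the denominator is $0$); then draw each $\xi_{k+1}^{(i)}$ independently from $P_{k+1}^{t_{k+1}}(\hat\xi_{k+1}^{(i)},\cdot)$. Let $\hat\mu_n$ be the marginal law of a particle $\xi_n^{(i)}$ (any $i$). **Statement (total variation bound).** For every $\epsilon>0$, if $$N\ \ge\ n\cdot\max\left\{\frac{16\,\gamma M}{w^*\epsilon^2},\ \frac{128\,\gamma^{35/8}M^{7/4}}{(w^*)^{15/8}}\right\}\qquad\text{and}\qquad t_k\ \ge\ 2\,C_k^*\,\gamma^7\quad(1\le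 k\le n),$$ then $$\|\hat\mu_n-\mu_n\|_{\mathrm{TV}}=\sup_{A\text{ measurable}}|\hat\mu_n(A)-\mu_n(A)|\ \le\ \epsilon .$$ -/

import Mathlib

open MeasureTheory ProbabilityTheory Filter Topology
open scoped NNReal ENNReal

noncomputable section

namespace SMC

variable {E : Type*} [MeasurableSpace E]

/-! ### Markov semigroups, generators and Dirichlet forms -/

/-- A Markov transition semigroup `(P^t)_{t ≥ 0}` on `E`:
`P^0 = id` and `P^{s+t} = P^s P^t` (Chapman-Kolmogorov). -/
structure MarkovSemigroup (E : Type*) [MeasurableSpace E] where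
  kernel : ℝ≥0 → Kernel E E
  isMarkov : ∀ t, IsMarkovKernel (kernel t)
  kernel_zero : kernel 0 = Kernel.id
  kernel_add : ∀ s t, kernel (s + t) = kernel s ∘ₖ kernel t

instance (P : MarkovSemigroup E) (t : ℝ≥0) : IsMarkovKernel (P.kernel t) := P.isMarkov t

/-- The action on functions, `(P^t f)(x) = ∫ f(y) P^t(x, dy)`. -/
def MarkovSemigroup.act (P : MarkovSemigroup E) (t : ℝ≥0) (f : E → ℝ) (x : E) : ℝ :=
  ∫ y, f y ∂(P.kernel t x)

/-- `P` is a Markov semigroup with stationary distribution `π`: every `P^t` leaves `π` invariant,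
and `P^t f → f` in `L²(π)` as `t ↓ 0` for every `f ∈ L²(π)`. -/
structure MarkovSemigroup.IsStationary (P : MarkovSemigroup E) (π : Measure E) : Prop where
  isProb : IsProbabilityMeasure π
  invariant : ∀ t, Kernel.Invariant (P.kernel t) π
  continuous : ∀ f : E → ℝ, MemLp f 2 π →
    Tendsto (fun t : ℝ≥0 => eLpNorm (fun x => P.act t f x - f x) 2 π) (𝓝[>] 0) (𝓝 0)

/-- `P` is reversible with respect to `π` (detailed balance at all times), i.e. every `P^t` is
self-adjoint on `L²(π)`. -/
def MarkovSemigroup.IsReversible (P : MarkovSemigroup E) (π : Measure E) : Prop :=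
  ∀ t, Kernel.IsReversible (P.kernel t) π

/-- `f` lies in the domain of the `L²(π)`-generator `𝓛` of `P`, and `𝓛 f = h`:
`(P^t f - f) / t → h` in `L²(π)` as `t ↓ 0`. -/
def MarkovSemigroup.HasGenerator (P : MarkovSemigroup E) (π : Measure E) (f h : E → ℝ) : Prop :=
  MemLp f 2 π ∧ MemLp h 2 π ∧
    Tendsto (fun t : ℝ≥0 => eLpNorm (fun x => (P.act t f x - f x) / t - h x) 2 π)
      (𝓝[>] 0) (𝓝 0)

/-- The Dirichlet form `𝓔(f, f) = -⟨f, 𝓛 f⟩_π = lim_{t ↓ 0} ⟨f, f - P^t f⟩_π / t`, as a quadratic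
form on all of `L²(π)` with the value `∞` outside its domain. On the domain of the generator it is
`-⟨f, 𝓛 f⟩_π` (`dirichletForm_eq` below); for a reversible semigroup it is the usual closed
Dirichlet form, `⟨f, f - P^t f⟩_π / t` being monotone in `t`. -/
def MarkovSemigroup.dirichletForm (P : MarkovSemigroup E) (π : Measure E) (f : E → ℝ) : ℝ≥0∞ :=
  liminf (fun t : ℝ≥0 => ENNReal.ofReal ((∫ x, f x * (f x - P.act t f x) ∂π) / t)) (𝓝[>] 0)

/-- `P^t f` is almost everywhere strongly measurable. -/
theorem MarkovSemigroup.IsStationary.aestronglyMeasurable_act {P : MarkovSemigroup E}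
    {π : Measure E} (hP : P.IsStationary π) (t : ℝ≥0) {f : E → ℝ}
    (hf : AEStronglyMeasurable f π) : AEStronglyMeasurable (P.act t f) π := by
  have h1 : AEStronglyMeasurable f (π.bind (P.kernel t)) := by
    rw [(hP.invariant t).def]; exact hf
  obtain ⟨f', hf', hff'⟩ := h1
  have h2 : ∀ᵐ x ∂π, ∀ᵐ y ∂(P.kernel t x), f y = f' y :=
    Measure.ae_ae_of_ae_bind (P.kernel t).aemeasurable hff'
  refine ⟨fun x => ∫ y, f' y ∂(P.kernel t x), ?_, ?_⟩
  · exact hf'.integral_kernel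
  · filter_upwards [h2] with x hx
    exact integral_congr_ae hx

/-- The Dirichlet form is `-⟨f, 𝓛 f⟩_π` on the domain of the generator. -/
theorem MarkovSemigroup.dirichletForm_eq {P : MarkovSemigroup E} {π : Measure E}
    (hP : P.IsStationary π) {f h : E → ℝ} (hfh : P.HasGenerator π f h) :
    P.dirichletForm π f = ENNReal.ofReal (-∫ x, f x * h x ∂π) := by
  obtain ⟨hf, hh, hlim⟩ := hfh
  have hD : ∀ t : ℝ≥0, AEStronglyMeasurable (fun x => (P.act t f x - f x) / t - h x) π := by
    intro t
    have := ((hP.aestronglyMeasurable_act t hf.1).sub hf.1).mul_const ((t : ℝ)⁻¹)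
    exact (this.congr (ae_of_all _ fun x => by simp [div_eq_mul_inv])).sub hh.1
  have hmem : ∀ᶠ t : ℝ≥0 in 𝓝[>] 0, MemLp (fun x => (P.act t f x - f x) / t) 2 π := by
    filter_upwards [hlim.eventually (gt_mem_nhds ENNReal.zero_lt_top)] with t ht
    have h1 : MemLp (fun x => (P.act t f x - f x) / t - h x) 2 π := ⟨hD t, ht⟩
    exact (h1.add hh).ae_eq (ae_of_all _ fun x => by simp)
  have key : Tendsto (fun t : ℝ≥0 => ∫ x, f x * ((P.act t f x - f x) / t) ∂π) (𝓝[>] 0)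
      (𝓝 (∫ x, f x * h x ∂π)) := by
    refine tendsto_integral_of_L1' _ (hf.integrable_mul hh).1 ?_ ?_
    · filter_upwards [hmem] with t ht
      exact hf.integrable_mul ht
    · have h0 : Tendsto (fun t : ℝ≥0 => eLpNorm f 2 π *
          eLpNorm (fun x => (P.act t f x - f x) / t - h x) 2 π) (𝓝[>] 0) (𝓝 0) := by
        simpa using ENNReal.Tendsto.const_mul (a := eLpNorm f 2 π) hlim (Or.inr hf.2.ne)
      refine tendsto_of_tendsto_of_tendsto_of_le_of_le tendsto_const_nhds h0
        (fun _ => zero_le) fun t => ?_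
      have h2 := eLpNorm_smul_le_mul_eLpNorm (p := 2) (q := 2) (r := 1) (hD t) hf.1
      refine le_trans (le_of_eq ?_) h2
      congr 1
      funext x
      simp [mul_sub]
  refine Tendsto.liminf_eq ((ENNReal.tendsto_ofReal key.neg).congr fun t => ?_)
  congr 1
  rw [← integral_neg, ← integral_div]
  refine integral_congr_ae (ae_of_all _ fun x => ?_)
  simp only
  ring

/-- The entropy `Ent_π(h) = π(h log h) - π(h) log π(h)`. -/
def entropy (π : Measure E) (h : E → ℝ) : ℝ :=
  (∫ x, h x * Real.log (h x) ∂π) - (∫ x, h x ∂π) * Real.log (∫ x, h x ∂π)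

/-- The logarithmic Sobolev inequality `Ent_π(f²) ≤ c · 𝓔(f, f)` for all `f` in the domain of the
Dirichlet form (finiteness of the entropy being part of the claim). -/
def LogSobolev (P : MarkovSemigroup E) (π : Measure E) (c : ℝ) : Prop :=
  ∀ f : E → ℝ, MemLp f 2 π → P.dirichletForm π f ≠ ∞ →
    Integrable (fun x => f x ^ 2 * Real.log (f x ^ 2)) π ∧
      entropy π (fun x => f x ^ 2) ≤ c * (P.dirichletForm π f).toReal

/-! ### The assumptions -/

/-- The assumptions at one level: `P` is a reversible Markov semigroup with stationary distribution
`μ`; `μ = ∑ i, w i • ν i` is a mixture with positive weights; the Dirichlet form of `P` dominates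
the mixture of the Dirichlet forms of Markov semigroups `Q i` with stationary distributions `ν i`,
i.e. `⟨f, 𝓛 f⟩_μ ≤ ∑ i, w i * ⟨f, 𝓛_i f⟩_{ν i}`; and each `ν i` satisfies a log-Sobolev inequality
with constant `c i` for the Dirichlet form of `Q i`. -/
structure LevelAssumption (μ : Measure E) (P : MarkovSemigroup E) {m : ℕ} (w : Fin m → ℝ)
    (ν : Fin m → Measure E) (Q : Fin m → MarkovSemigroup E) (c : Fin m → ℝ) : Prop where
  stationary : P.IsStationary μ
  reversible : P.IsReversible μ
  weight_pos : ∀ i, 0 < w i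
  weight_sum : ∑ i, w i = 1
  mixture : μ = ∑ i, ENNReal.ofReal (w i) • ν i
  stationary_comp : ∀ i, (Q i).IsStationary (ν i)
  decomposition : ∀ f : E → ℝ, MemLp f 2 μ →
    ∑ i, ENNReal.ofReal (w i) * (Q i).dirichletForm (ν i) f ≤ P.dirichletForm μ f
  logSobolev : ∀ i, LogSobolev (Q i) (ν i) (c i)

/-- The assumptions on the levels `1, …, n`. The function `g k` is a version of the density
`dμ_{k+1}/dμ_k`, and the density ratios are bounded by `γ`. -/
structure Assumption (n : ℕ) (μ : ℕ → Measure E) (P : ℕ → MarkovSemigroup E) {m : ℕ → ℕ}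
    (w : ∀ k, Fin (m k) → ℝ) (ν : ∀ k, Fin (m k) → Measure E)
    (Q : ∀ k, Fin (m k) → MarkovSemigroup E) (c : ∀ k, Fin (m k) → ℝ)
    (g : ℕ → E → ℝ≥0) (γ : ℝ) : Prop where
  level : ∀ k, 1 ≤ k → k ≤ n → LevelAssumption (μ k) (P k) (w k) (ν k) (Q k) (c k)
  density : ∀ k, 1 ≤ k → k < n → μ (k + 1) = (μ k).withDensity (fun x => (g k x : ℝ≥0∞))
  density_le : ∀ k, 1 ≤ k → k < n → ∀ᵐ x ∂(μ k), (g k x : ℝ) ≤ γ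

/-! ### The Sequential Monte Carlo algorithm -/

/-- A product of finitely many finite kernels, `x ↦ ⨂ i, κ i x`, is measurable. -/
theorem measurable_pi_kernel {X : Type*} [MeasurableSpace X] {N : ℕ} (κ : Fin N → Kernel X E)
    [∀ i, IsFiniteKernel (κ i)] : Measurable fun x => Measure.pi fun i => κ i x := by
  refine Measurable.measure_of_isPiSystem (S := Set.pi Set.univ ''
    Set.pi Set.univ fun _ : Fin N => {s : Set E | MeasurableSet s})
    generateFrom_pi.symm isPiSystem_pi ?_ ?_
  · rintro _ ⟨s, hs, rfl⟩
    simp only [Measure.pi_pi]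
    exact Finset.measurable_prod _ fun i _ => (κ i).measurable_coe (hs i (Set.mem_univ i))
  · simp only [Measure.pi_univ]
    exact Finset.measurable_prod _ fun i _ => (κ i).measurable_coe MeasurableSet.univ

/-- The product kernel `x ↦ ⨂ i, κ i x`: given `x`, the coordinates are drawn independently, the
`i`-th one from `κ i x`. -/
def piKernel {X : Type*} [MeasurableSpace X] {N : ℕ} (κ : Fin N → Kernel X E)
    [∀ i, IsFiniteKernel (κ i)] : Kernel X (Fin N → E) :=
  ⟨fun x => Measure.pi fun i => κ i x, measurable_pi_kernel κ⟩

/-- The normalized weight `g(ξ_j) / ∑ l, g(ξ_l)` of particle `j`; if all the weights vanish, so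
that this is undefined, every particle gets the weight `1 / N`. -/
def weight {X : Type*} {N : ℕ} (g : X → ℝ≥0) (ξ : Fin N → X) (j : Fin N) : ℝ≥0 :=
  open Classical in
  if ∑ l, g (ξ l) = 0 then 1 / N else g (ξ j) / ∑ l, g (ξ l)

theorem measurable_weight {N : ℕ} {g : E → ℝ≥0} (hg : Measurable g) (j : Fin N) :
    Measurable fun ξ : Fin N → E => weight g ξ j := by
  classical
  have h1 : Measurable fun ξ : Fin N → E => ∑ l, g (ξ l) :=
    Finset.measurable_sum _ fun l _ => hg.comp (measurable_pi_apply l)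
  unfold weight
  exact Measurable.ite (h1 (measurableSet_singleton 0)) measurable_const
    ((hg.comp (measurable_pi_apply j)).div h1)

theorem sum_weight_le {X : Type*} {N : ℕ} (g : X → ℝ≥0) (ξ : Fin N → X) : ∑ j, weight g ξ j ≤ 1 := by
  unfold weight
  split_ifs with h
  · simpa using mul_inv_le_one
  · rw [← Finset.sum_div]
    exact div_self_le_one _

/-- The weighted empirical measure `∑ j, W_j δ_{ξ_j}` of the particles. -/
def weightedEmpirical {N : ℕ} (g : E → ℝ≥0) (hg : Measurable g) : Kernel (Fin N → E) E :=
  ⟨fun ξ => ∑ j, (weight g ξ j : ℝ≥0∞) • Measure.dirac (ξ j), by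
    refine Measure.measurable_of_measurable_coe _ fun s hs => ?_
    simp only [Measure.coe_finsetSum, Finset.sum_apply, Measure.smul_apply, smul_eq_mul]
    exact Finset.measurable_sum _ fun j _ => (measurable_weight hg j).coe_nnreal_ennreal.mul
      ((Measure.measurable_coe hs).comp (Measure.measurable_dirac.comp (measurable_pi_apply j)))⟩

instance {N : ℕ} (g : E → ℝ≥0) (hg : Measurable g) :
    IsFiniteKernel (weightedEmpirical (N := N) g hg) := by
  refine ⟨1, ENNReal.one_lt_top, fun ξ => ?_⟩
  change (∑ j, (weight g ξ j : ℝ≥0∞) • Measure.dirac (ξ j)) Set.univ ≤ 1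
  simp only [Measure.coe_finsetSum, Finset.sum_apply, Measure.smul_apply, smul_eq_mul,
    measure_univ, mul_one]
  exact_mod_cast sum_weight_le g ξ

/-- Multinomial resampling: given `ξ`, draw `N` independent samples from the weighted empirical
measure of `ξ`. -/
def resample (N : ℕ) (g : E → ℝ≥0) (hg : Measurable g) : Kernel (Fin N → E) (Fin N → E) :=
  piKernel fun _ => weightedEmpirical g hg

/-- Mutation: move every particle independently by the kernel `K`. -/
def mutate (N : ℕ) (K : Kernel E E) [IsMarkovKernel K] : Kernel (Fin N → E) (Fin N → E) :=
  piKernel fun i => K.comap (fun ξ : Fin N → E => ξ i) (measurable_pi_apply i)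

/-- The joint law of the `N` particles at level `k` (levels start at `1`; the value at `0` is not
used): at level `1` they are independent with law `μ 1`; to get from level `k` to `k + 1` they are
resampled with weights proportional to `g k` and then moved by `P_{k+1}^{t_{k+1}}`. -/
def particleLaw (N : ℕ) (μ : ℕ → Measure E) (P : ℕ → MarkovSemigroup E) (t : ℕ → ℝ≥0)
    (g : ℕ → E → ℝ≥0) (hg : ∀ k, Measurable (g k)) : ℕ → Measure (Fin N → E)
  | 0 => 0
  | 1 => Measure.pi fun _ => μ 1
  | k + 2 => ((particleLaw N μ P t g hg (k + 1)).bind (resample N (g (k + 1)) (hg (k + 1)))).bind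
      (mutate N ((P (k + 2)).kernel (t (k + 2))))

/-- The marginal law of the `i`-th particle at level `k`. -/
def marginalLaw (N : ℕ) (μ : ℕ → Measure E) (P : ℕ → MarkovSemigroup E) (t : ℕ → ℝ≥0)
    (g : ℕ → E → ℝ≥0) (hg : ∀ k, Measurable (g k)) (k : ℕ) (i : Fin N) : Measure E :=
  (particleLaw N μ P t g hg k).map fun ξ => ξ i

/-- The total variation distance `sup_A |π(A) - ρ(A)|` over measurable sets `A`. -/
def tvDist (π ρ : Measure E) : ℝ :=
  ⨆ A : {A : Set E // MeasurableSet A}, |π.real A - ρ.real A|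

end SMC

end

/-!
# Total variation bound for sequential Monte Carlo on mixtures

Let `φ` be the normalizing constant of the particle system, the product over the levels of the mean
weight of the particles. Reweighting by `φ` makes every particle unbiased: `E[φ f(ξ^i)] = μ_n(f)`
(`lintegral_weightedLaw_eval`). Hence the total variation distance between the law of a particle and
`μ_n` is at most `E|1 - φ| ≤ (E[φ²] - 1)^{1/2}` (`abs_measureReal_sub_le`), and it remains to show
`E[φ²] ≤ 1 + ε²` (`SmoothingLevels.lintegral_sq_weightedLaw_le`).

Given the particles of one level, those of the next are independent and identically distributed
(`particleKernel_apply`), so two lineages followed backwards share a draw with probability `1 / N`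
per level and are otherwise independent (`secondMoment_succ_le`). Thus `E[φ²] - 1` is `1 / N` times
the sum over the levels of the contributions of a last coalescence, tested against `(Q_{k,n} 1)²`,
where `Q_{j,k}` is the Feynman-Kac semigroup generated by `f ↦ g_k · K_{k+1} f`. To first order the
contribution of level `k` is `μ_k((Q_{k,n} 1)²)`, and the corrections due to earlier coalescences
are controlled as soon as `F ↦ Q_{j,k} 1 · Q_{j,k} F` is bounded on `L^{3/2}` uniformly in the number
of levels crossed (`SmoothingLevels.coalescence_le`).

These bounds come from smoothing of the mutation kernels, not from their convergence to equilibrium,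
which the assumptions do not provide. The log-Sobolev inequalities of the components imply a
defective one for the mixture, with defect `log W`, where `W = 1 / min w`
(`LevelAssumption.defectiveLogSobolev`), and Gross' argument turns it into hypercontractivity,
`‖P^t f‖_q ≤ W^{1/2 - 1/q} ‖f‖_2` for `C log (q/2) ≤ 2t` (`lintegral_lact_rpow_le`). The derivative
of the norms is taken in the sense of upper right Dini derivatives, which fits the definition of the
Dirichlet form as a lower limit and requires neither the domain of the generator nor
differentiability; the inequality `(P^h u)^q ≤ (P^h u^{q/2})²` replaces the Stroock-Varopoulos
inequality. By self-adjointness there is a dual bound from `L^{q'}` to `L²`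
(`lintegral_lact_sq_le`).

Since `Q_{j,k}` preserves means, smoothing and interpolation between `L¹` and the target space bound
a norm of `Q_{j,k} f` by a power less than one of the same norm of `Q_{j+1,k} f`. Iteration over the
levels therefore gives bounds that do not grow with their number: `μ_j((Q_{j,k} 1)²) ≤ 2 γ W`
(`SmoothingLevels.lintegral_feynmanKac_one_sq_le`) and boundedness of `Q_{j,k}` on `L^{3/2}`
(`SmoothingLevels.lintegral_feynmanKac_rpow_le`).
-/

noncomputable section

namespace SMC

variable {E : Type*} [MeasurableSpace E]

/-! ### The action of a Markov semigroup on bounded functions -/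

theorem integrable_of_mem_Icc {X : Type*} [MeasurableSpace X] {π : Measure X} [IsFiniteMeasure π]
    {f : X → ℝ} (hf : Measurable f) {a b : ℝ} (hab : ∀ x, f x ∈ Set.Icc a b) : Integrable f π :=
  Integrable.of_mem_Icc a b hf.aemeasurable (ae_of_all _ hab)

theorem MarkovSemigroup.measurable_act (P : MarkovSemigroup E) (t : ℝ≥0) {f : E → ℝ}
    (hf : Measurable f) : Measurable (P.act t f) :=
  (hf.stronglyMeasurable.integral_kernel (κ := P.kernel t)).measurable

theorem MarkovSemigroup.act_mem_Icc (P : MarkovSemigroup E) (t : ℝ≥0) {f : E → ℝ}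
    (hf : Measurable f) {a b : ℝ} (hab : ∀ x, f x ∈ Set.Icc a b) (x : E) :
    P.act t f x ∈ Set.Icc a b := by
  have hi : Integrable f (P.kernel t x) := integrable_of_mem_Icc hf hab
  constructor
  · refine le_trans (by simp) (integral_mono (μ := P.kernel t x) (integrable_const a) hi fun y => (hab y).1)
  · exact (integral_mono (μ := P.kernel t x) hi (integrable_const b) fun y => (hab y).2).trans (by simp)

theorem MarkovSemigroup.act_zero (P : MarkovSemigroup E) {f : E → ℝ} (hf : Measurable f) :
    P.act 0 f = f := by
  funext x
  simp [MarkovSemigroup.act, P.kernel_zero, Kernel.id_apply,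
    integral_dirac' f x hf.stronglyMeasurable]

theorem MarkovSemigroup.act_act (P : MarkovSemigroup E) (s t : ℝ≥0) {f : E → ℝ}
    (hf : Measurable f) {a b : ℝ} (hab : ∀ x, f x ∈ Set.Icc a b) :
    P.act t (P.act s f) = P.act (s + t) f := by
  funext x
  simp only [MarkovSemigroup.act, P.kernel_add]
  rw [Kernel.integral_comp]
  exact integrable_of_mem_Icc hf hab

theorem MarkovSemigroup.act_sub (P : MarkovSemigroup E) (t : ℝ≥0) {f g : E → ℝ}
    (hf : Measurable f) {a b : ℝ} (hab : ∀ x, f x ∈ Set.Icc a b)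
    (hg : Measurable g) {c d : ℝ} (hcd : ∀ x, g x ∈ Set.Icc c d) (x : E) :
    P.act t (fun y => f y - g y) x = P.act t f x - P.act t g x :=
  integral_sub (integrable_of_mem_Icc hf hab) (integrable_of_mem_Icc hg hcd)

/-- Detailed balance as a symmetry of the joint law of the two ends of a transition. -/
theorem map_swap_compProd_of_isReversible {π : Measure E} [IsFiniteMeasure π] {κ : Kernel E E}
    [IsMarkovKernel κ] (h : Kernel.IsReversible κ π) :
    (π ⊗ₘ κ).map Prod.swap = π ⊗ₘ κ := by
  refine Measure.ext_prod fun {s t} hs ht => ?_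
  rw [Measure.map_apply measurable_swap (hs.prod ht), Set.preimage_swap_prod,
    Measure.compProd_apply_prod ht hs, Measure.compProd_apply_prod hs ht, h hs ht]

theorem lintegral_mul_kernel_comm {π : Measure E} [IsFiniteMeasure π] {κ : Kernel E E}
    [IsMarkovKernel κ] (h : Kernel.IsReversible κ π) {f g : E → ℝ≥0∞} (hf : Measurable f)
    (hg : Measurable g) :
    ∫⁻ x, f x * ∫⁻ y, g y ∂κ x ∂π = ∫⁻ x, g x * ∫⁻ y, f y ∂κ x ∂π := by
  have key : ∀ {f g : E → ℝ≥0∞}, Measurable f → Measurable g →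
      ∫⁻ x, f x * ∫⁻ y, g y ∂κ x ∂π = ∫⁻ z, f z.1 * g z.2 ∂(π ⊗ₘ κ) := by
    intro f g hf hg
    rw [Measure.lintegral_compProd (by fun_prop)]
    exact lintegral_congr fun x => (lintegral_const_mul _ hg).symm
  rw [key hf hg, key hg hf]
  conv_lhs => rw [← map_swap_compProd_of_isReversible h]
  rw [lintegral_map (by fun_prop) measurable_swap]
  simp [mul_comm]

theorem MarkovSemigroup.integral_mul_act_comm {P : MarkovSemigroup E} {π : Measure E}
    [IsProbabilityMeasure π] (hr : P.IsReversible π) (t : ℝ≥0) {f g : E → ℝ}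
    (hf : Measurable f) {a b : ℝ} (hab : ∀ x, f x ∈ Set.Icc a b)
    (hg : Measurable g) {c d : ℝ} (hcd : ∀ x, g x ∈ Set.Icc c d) :
    ∫ x, f x * P.act t g x ∂π = ∫ x, g x * P.act t f x ∂π := by
  have key : ∀ {f g : E → ℝ} {a b c d : ℝ}, Measurable f → (∀ x, f x ∈ Set.Icc a b) →
      Measurable g → (∀ x, g x ∈ Set.Icc c d) →
      ∫ x, f x * P.act t g x ∂π = ∫ z, f z.1 * g z.2 ∂(π ⊗ₘ P.kernel t) := by
    intro f g a b c d hf hab hg hcd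
    rw [Measure.integral_compProd]
    · exact integral_congr_ae (ae_of_all _ fun x => (integral_const_mul _ _).symm)
    · refine Integrable.bdd_mul (c := max |a| |b|)
        (integrable_of_mem_Icc (hg.comp measurable_snd) fun z => hcd z.2)
        (hf.comp measurable_fst).aestronglyMeasurable (ae_of_all _ fun z => ?_)
      exact abs_le_max_abs_abs (hab z.1).1 (hab z.1).2
  rw [key hf hab hg hcd, key hg hcd hf hab]
  conv_lhs => rw [← map_swap_compProd_of_isReversible (hr t)]
  rw [integral_map measurable_swap.aemeasurable (by fun_prop)]
  simp [mul_comm]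

theorem MarkovSemigroup.IsStationary.integral_act {P : MarkovSemigroup E} {π : Measure E}
    (hP : P.IsStationary π) (t : ℝ≥0) {f : E → ℝ} (hf : Measurable f) {a b : ℝ}
    (hab : ∀ x, f x ∈ Set.Icc a b) : ∫ x, P.act t f x ∂π = ∫ x, f x ∂π := by
  have := hP.isProb
  conv_rhs => rw [← (hP.invariant t).def]
  rw [← Measure.snd_compProd, Measure.snd,
    integral_map measurable_snd.aemeasurable hf.aestronglyMeasurable, Measure.integral_compProd]
  · rfl
  · exact integrable_of_mem_Icc (hf.comp measurable_snd) fun z => hab z.2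

theorem MarkovSemigroup.IsStationary.lintegral_kernel {P : MarkovSemigroup E} {π : Measure E}
    (hP : P.IsStationary π) (t : ℝ≥0) {f : E → ℝ≥0∞} (hf : Measurable f) :
    ∫⁻ x, ∫⁻ y, f y ∂(P.kernel t x) ∂π = ∫⁻ x, f x ∂π := by
  conv_rhs => rw [← (hP.invariant t).def]
  rw [Measure.lintegral_bind (P.kernel t).aemeasurable hf.aemeasurable]

/-! ### Continuity along the semigroup -/

/-- `P^t` contracts `L¹(π)`. -/
theorem MarkovSemigroup.IsStationary.integral_abs_act_le {P : MarkovSemigroup E} {π : Measure E}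
    (hP : P.IsStationary π) (t : ℝ≥0) {f : E → ℝ} (hf : Measurable f) {a b : ℝ}
    (hab : ∀ x, f x ∈ Set.Icc a b) : ∫ x, |P.act t f x| ∂π ≤ ∫ x, |f x| ∂π := by
  have := hP.isProb
  have habs : ∀ x, |f x| ∈ Set.Icc 0 (max |a| |b|) := fun x =>
    ⟨abs_nonneg _, abs_le_max_abs_abs (hab x).1 (hab x).2⟩
  have habs' : ∀ x, |P.act t f x| ∈ Set.Icc 0 (max |a| |b|) := fun x =>
    ⟨abs_nonneg _, abs_le_max_abs_abs (P.act_mem_Icc t hf hab x).1 (P.act_mem_Icc t hf hab x).2⟩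
  have hm : Measurable fun x => |f x| := hf.abs
  rw [← hP.integral_act t hm habs]
  refine integral_mono (integrable_of_mem_Icc (P.measurable_act t hf).abs habs')
    (integrable_of_mem_Icc (P.measurable_act t hm) (P.act_mem_Icc t hm habs)) fun x => ?_
  exact abs_integral_le_integral_abs

/-- `t ↦ P^t f` is uniformly continuous in `L¹(π)`, with modulus `h ↦ ‖P^h f - f‖`. -/
theorem MarkovSemigroup.IsStationary.integral_abs_act_sub_act_le {P : MarkovSemigroup E}
    {π : Measure E} (hP : P.IsStationary π) (t h : ℝ≥0) {f : E → ℝ} (hf : Measurable f) {a b : ℝ}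
    (hab : ∀ x, f x ∈ Set.Icc a b) :
    ∫ x, |P.act (h + t) f x - P.act t f x| ∂π ≤ ∫ x, |P.act h f x - f x| ∂π := by
  have h1 := hP.integral_abs_act_le t (f := fun x => P.act h f x - f x)
    ((P.measurable_act h hf).sub hf) (a := a - b) (b := b - a) fun x => by
      have h1 := P.act_mem_Icc h hf hab x
      have h2 := hab x
      exact ⟨by linarith [h1.1, h2.2], by linarith [h1.2, h2.1]⟩
  refine le_trans (le_of_eq ?_) h1
  congr 1
  funext x
  rw [P.act_sub t (P.measurable_act h hf) (P.act_mem_Icc h hf hab) hf hab, P.act_act h t hf hab]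

theorem MarkovSemigroup.IsStationary.tendsto_integral_abs_act_sub {P : MarkovSemigroup E}
    {π : Measure E} (hP : P.IsStationary π) {f : E → ℝ} (hf : Measurable f) {a b : ℝ}
    (hab : ∀ x, f x ∈ Set.Icc a b) :
    Tendsto (fun h : ℝ≥0 => ∫ x, |P.act h f x - f x| ∂π) (𝓝 0) (𝓝 0) := by
  have := hP.isProb
  have hL : MemLp f 2 π := MemLp.of_bound hf.aestronglyMeasurable (max |a| |b|)
    (ae_of_all _ fun x => abs_le_max_abs_abs (hab x).1 (hab x).2)
  have h1 : Tendsto (fun h : ℝ≥0 => (eLpNorm (fun x => P.act h f x - f x) 2 π).toReal)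
      (𝓝[>] 0) (𝓝 0) := by
    exact (ENNReal.tendsto_toReal ENNReal.zero_ne_top).comp (hP.continuous f hL)
  have hb : ∀ (h : ℝ≥0) x, ‖P.act h f x - f x‖ ≤ b - a := fun h x => by
    have h1 := P.act_mem_Icc h hf hab x
    have h2 := hab x
    rw [Real.norm_eq_abs, abs_le]
    constructor <;> linarith [h1.1, h1.2, h2.1, h2.2]
  have h2 : Tendsto (fun h : ℝ≥0 => ∫ x, |P.act h f x - f x| ∂π) (𝓝[>] 0) (𝓝 0) := by
    refine tendsto_of_tendsto_of_tendsto_of_le_of_le tendsto_const_nhds h1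
      (fun h => integral_nonneg fun x => abs_nonneg _) fun h => ?_
    have hm : AEStronglyMeasurable (fun x => P.act h f x - f x) π :=
      ((P.measurable_act h hf).sub hf).aestronglyMeasurable
    have hL2 : MemLp (fun x => P.act h f x - f x) 2 π := MemLp.of_bound hm _ (ae_of_all _ (hb h))
    have h3 := eLpNorm_le_eLpNorm_of_exponent_le (p := 1) (q := 2) (by norm_num) hm
    have h4 := ENNReal.toReal_mono hL2.2.ne h3
    refine le_trans (le_of_eq ?_) h4
    rw [eLpNorm_one_eq_lintegral_enorm, ← integral_norm_eq_lintegral_enorm hm]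
    rfl
  rw [show (𝓝 (0 : ℝ≥0)) = 𝓝[≥] 0 by
    rw [show Set.Ici (0 : ℝ≥0) = Set.univ from Set.eq_univ_of_forall fun x => zero_le (a := x), nhdsWithin_univ],
    ← Set.Ioi_insert, nhdsWithin_insert, tendsto_sup]
  refine ⟨?_, h2⟩
  rw [tendsto_pure_left]
  intro s hs
  simpa [P.act_zero hf] using mem_of_mem_nhds hs

/-- If bounded functions `u z` converge to `u x` in `L¹`, then `∫ F (z, u z)` converges to
`∫ F (x, u x)` for `F` continuous on a compact rectangle: uniform continuity bounds the difference
of the integrands by `ε + K |u z - u x|`. -/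
theorem continuousWithinAt_integral_comp {X : Type*} [MeasurableSpace X] {π : Measure X}
    [IsProbabilityMeasure π] {a b c d : ℝ} {u : ℝ → X → ℝ} (hu : ∀ z, Measurable (u z))
    (hab : ∀ z x, u z x ∈ Set.Icc a b) {F : ℝ × ℝ → ℝ}
    (hF : ContinuousOn F (Set.Icc c d ×ˢ Set.Icc a b)) (hFm : ∀ z, Measurable fun y => F (z, y))
    {s : ℝ} (hs : s ∈ Set.Icc c d)
    (hlim : Tendsto (fun z => ∫ x, |u z x - u s x| ∂π) (𝓝[Set.Icc c d] s) (𝓝 0)) :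
    ContinuousWithinAt (fun z => ∫ x, F (z, u z x) ∂π) (Set.Icc c d) s := by
  have hK : IsCompact (Set.Icc c d ×ˢ Set.Icc a b) := isCompact_Icc.prod isCompact_Icc
  obtain ⟨B, hB⟩ := hK.exists_bound_of_continuousOn hF
  have hB0 : 0 ≤ B := by
    obtain ⟨x⟩ := nonempty_of_isProbabilityMeasure π
    exact (norm_nonneg _).trans (hB (s, u s x) ⟨hs, hab s x⟩)
  have hUC := hK.uniformContinuousOn_of_continuous hF
  rw [Metric.uniformContinuousOn_iff] at hUC
  have hint : ∀ z ∈ Set.Icc c d, Integrable (fun x => F (z, u z x)) π := fun z hz =>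
    Integrable.of_bound ((hFm z).comp (hu z)).aestronglyMeasurable B
      (ae_of_all _ fun x => hB _ ⟨hz, hab z x⟩)
  have hdi : ∀ z, Integrable (fun x => |u z x - u s x|) π := fun z =>
    ((integrable_of_mem_Icc (hu z) (hab z)).sub (integrable_of_mem_Icc (hu s) (hab s))).abs
  rw [ContinuousWithinAt, Metric.tendsto_nhds]
  intro ε hε
  obtain ⟨δ, hδ, hUCδ⟩ := hUC (ε / 2) (by positivity)
  have hK' : 0 < ε / 4 / (2 * B / δ + 1) := by positivity
  filter_upwards [self_mem_nhdsWithin, hlim.eventually (gt_mem_nhds hK'),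
    mem_nhdsWithin_of_mem_nhds (Metric.ball_mem_nhds s hδ)] with z hz hz1 hz2
  rw [Real.dist_eq, ← integral_sub (hint z hz) (hint s hs)]
  have hpt : ∀ x, |F (z, u z x) - F (s, u s x)| ≤ ε / 2 + (2 * B / δ + 1) * |u z x - u s x| := by
    intro x
    rcases lt_or_ge |u z x - u s x| δ with h | h
    · have h1 := hUCδ (z, u z x) ⟨hz, hab z x⟩ (s, u s x) ⟨hs, hab s x⟩
        (by rw [Prod.dist_eq]; exact max_lt hz2 h)
      rw [Real.dist_eq] at h1
      have : 0 ≤ (2 * B / δ + 1) * |u z x - u s x| := by positivity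
      linarith
    · have h1 : |F (z, u z x) - F (s, u s x)| ≤ 2 * B := by
        have h2 := hB (z, u z x) ⟨hz, hab z x⟩
        have h3 := hB (s, u s x) ⟨hs, hab s x⟩
        rw [Real.norm_eq_abs] at h2 h3
        have := abs_sub (F (z, u z x)) (F (s, u s x))
        linarith
      have h2 : 2 * B ≤ 2 * B / δ * |u z x - u s x| := by
        rw [div_mul_eq_mul_div, le_div_iff₀ hδ]
        gcongr
      have := abs_nonneg (u z x - u s x)
      linarith
  calc |∫ x, F (z, u z x) - F (s, u s x) ∂π|
      ≤ ∫ x, |F (z, u z x) - F (s, u s x)| ∂π := abs_integral_le_integral_abs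
    _ ≤ ∫ x, (ε / 2 + (2 * B / δ + 1) * |u z x - u s x|) ∂π :=
        integral_mono ((hint z hz).sub (hint s hs)).abs
          ((integrable_const _).add ((hdi z).const_mul _)) hpt
    _ = ε / 2 + (2 * B / δ + 1) * ∫ x, |u z x - u s x| ∂π := by
        rw [integral_add (integrable_const _) ((hdi z).const_mul _), integral_const_mul]
        simp
    _ < ε := by
        rw [lt_div_iff₀ (by positivity)] at hz1
        linarith

/-- `t ↦ P^t f` is continuous in `L¹(π)`. -/
theorem MarkovSemigroup.IsStationary.tendsto_integral_abs_act_sub_act {P : MarkovSemigroup E}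
    {π : Measure E} (hP : P.IsStationary π) {f : E → ℝ} (hf : Measurable f) {a b : ℝ}
    (hab : ∀ x, f x ∈ Set.Icc a b) (s : ℝ≥0) :
    Tendsto (fun z : ℝ≥0 => ∫ x, |P.act z f x - P.act s f x| ∂π) (𝓝 s) (𝓝 0) := by
  have h0 : Tendsto (fun z : ℝ≥0 => (z - s) + (s - z)) (𝓝 s) (𝓝 0) := by
    have : Continuous fun z : ℝ≥0 => (z - s) + (s - z) := by fun_prop
    simpa using this.tendsto s
  refine tendsto_of_tendsto_of_tendsto_of_le_of_le tendsto_const_nhds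
    ((hP.tendsto_integral_abs_act_sub hf hab).comp h0)
    (fun z => integral_nonneg fun x => abs_nonneg _) fun z => ?_
  simp only [Function.comp]
  rcases le_total s z with h | h
  · have := hP.integral_abs_act_sub_act_le s (z - s) hf hab
    rw [tsub_add_cancel_of_le h] at this
    rwa [tsub_eq_zero_of_le h, add_zero]
  · have := hP.integral_abs_act_sub_act_le z (s - z) hf hab
    rw [tsub_add_cancel_of_le h] at this
    rw [tsub_eq_zero_of_le h, zero_add]
    simpa only [abs_sub_comm] using this

/-! ### The defective log-Sobolev inequality of a mixture -/

/-- The defective log-Sobolev inequality `Ent_π(f²) ≤ C 𝓔(f, f) + L π(f²)`, for bounded functions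
bounded away from zero. -/
def DefectiveLogSobolev (P : MarkovSemigroup E) (π : Measure E) (C L : ℝ) : Prop :=
  ∀ f : E → ℝ, Measurable f → ∀ a b : ℝ, 0 < a → (∀ x, f x ∈ Set.Icc a b) →
    P.dirichletForm π f ≠ ∞ →
    entropy π (fun x => f x ^ 2) ≤ C * (P.dirichletForm π f).toReal + L * ∫ x, f x ^ 2 ∂π

theorem integral_mixture {m : ℕ} {w : Fin m → ℝ} (hw : ∀ i, 0 < w i) {ν : Fin m → Measure E}
    {h : E → ℝ} (hh : ∀ i, Integrable h (ν i)) :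
    ∫ x, h x ∂(∑ i, ENNReal.ofReal (w i) • ν i) = ∑ i, w i * ∫ x, h x ∂(ν i) := by
  rw [integral_finsetSum_measure fun i _ => (hh i).smul_measure ENNReal.ofReal_ne_top]
  refine Finset.sum_congr rfl fun i _ => ?_
  rw [integral_smul_measure, ENNReal.toReal_ofReal (hw i).le, smul_eq_mul]

/-- Log-Sobolev inequalities for the components give a defective one for the mixture: the entropy
splits into the mean entropy within the components and the entropy of the component means, and
the latter is at most `log (1 / min w)` times the total mean. -/
theorem LevelAssumption.defectiveLogSobolev {μ : Measure E} {P : MarkovSemigroup E} {m : ℕ}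
    {w : Fin m → ℝ} {ν : Fin m → Measure E} {Q : Fin m → MarkovSemigroup E} {c : Fin m → ℝ}
    (hA : LevelAssumption μ P w ν Q c) {C : ℝ} (hC : ∀ i, c i ≤ C) {wmin : ℝ}
    (hwmin : 0 < wmin) (hw : ∀ i, wmin ≤ w i) (hC0 : 0 ≤ C) :
    DefectiveLogSobolev P μ C (-Real.log wmin) := by
  intro f hf a b ha hab hfin
  have hprob := fun i => (hA.stationary_comp i).isProb
  have hμprob := hA.stationary.isProb
  have hb : ∀ x, ‖f x‖ ≤ b := fun x => by
    rw [Real.norm_eq_abs, abs_of_pos (ha.trans_le (hab x).1)]; exact (hab x).2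
  have hLμ : MemLp f 2 μ := MemLp.of_bound hf.aestronglyMeasurable b (ae_of_all _ hb)
  have hLν : ∀ i, MemLp f 2 (ν i) := fun i =>
    MemLp.of_bound hf.aestronglyMeasurable b (ae_of_all _ hb)
  have hdec := hA.decomposition f hLμ
  have hsum_fin : ∑ i, ENNReal.ofReal (w i) * (Q i).dirichletForm (ν i) f ≠ ∞ :=
    (hdec.trans_lt hfin.lt_top).ne
  have hDfin : ∀ i, (Q i).dirichletForm (ν i) f ≠ ∞ := by
    intro i hi
    refine ENNReal.sum_ne_top.1 hsum_fin i (Finset.mem_univ i) ?_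
    rw [hi]
    exact ENNReal.mul_top (by simpa using hA.weight_pos i)
  have hLS := fun i => hA.logSobolev i f (hLν i) (hDfin i)
  have hDsum : ∑ i, w i * ((Q i).dirichletForm (ν i) f).toReal
      ≤ (P.dirichletForm μ f).toReal := by
    have h1 := ENNReal.toReal_mono hfin hdec
    rw [ENNReal.toReal_sum (ENNReal.sum_ne_top.1 hsum_fin)] at h1
    refine le_trans (le_of_eq (Finset.sum_congr rfl fun i _ => ?_)) h1
    rw [ENNReal.toReal_mul, ENNReal.toReal_ofReal (hA.weight_pos i).le]
  have hsq : ∀ i, Integrable (fun x => f x ^ 2) (ν i) := fun i => (hLν i).integrable_sq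
  set x : Fin m → ℝ := fun i => ∫ y, f y ^ 2 ∂(ν i) with hx
  have hxpos : ∀ i, 0 < x i := fun i => by
    have h1 := integral_mono (μ := ν i) (integrable_const (a ^ 2)) (hsq i)
      fun y => pow_le_pow_left₀ ha.le (hab y).1 2
    simp only [integral_const, probReal_univ, one_smul] at h1
    exact lt_of_lt_of_le (by positivity) h1
  have hX : ∫ y, f y ^ 2 ∂μ = ∑ i, w i * x i := by
    conv_lhs => rw [hA.mixture]
    exact integral_mixture hA.weight_pos hsq
  have hEl : ∫ y, f y ^ 2 * Real.log (f y ^ 2) ∂μ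
      = ∑ i, w i * (entropy (ν i) (fun y => f y ^ 2) + x i * Real.log (x i)) := by
    conv_lhs => rw [hA.mixture]
    rw [integral_mixture hA.weight_pos fun i => (hLS i).1]
    refine Finset.sum_congr rfl fun i _ => ?_
    simp [entropy, hx]
  set X : ℝ := ∑ i, w i * x i with hXdef
  have hlog : ∀ i, Real.log (x i) ≤ Real.log X - Real.log wmin := by
    intro i
    have h1 : w i * x i ≤ X :=
      Finset.single_le_sum (f := fun i => w i * x i)
        (fun j _ => (mul_pos (hA.weight_pos j) (hxpos j)).le) (Finset.mem_univ i)
    have h2 : wmin * x i ≤ X := le_trans (mul_le_mul_of_nonneg_right (hw i) (hxpos i).le) h1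
    have h3 := Real.log_le_log (mul_pos hwmin (hxpos i)) h2
    rw [Real.log_mul hwmin.ne' (hxpos i).ne'] at h3
    linarith
  have hent : entropy μ (fun y => f y ^ 2)
      = ∑ i, w i * (entropy (ν i) (fun y => f y ^ 2) + x i * Real.log (x i))
        - X * Real.log X := by
    rw [entropy, hEl, hX]
  have hterm : ∀ i, w i * (entropy (ν i) (fun y => f y ^ 2) + x i * Real.log (x i))
      ≤ C * (w i * ((Q i).dirichletForm (ν i) f).toReal)
        + (w i * x i) * (Real.log X - Real.log wmin) := by
    intro i
    have h1 : entropy (ν i) (fun y => f y ^ 2) ≤ C * ((Q i).dirichletForm (ν i) f).toReal :=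
      (hLS i).2.trans (mul_le_mul_of_nonneg_right (hC i) ENNReal.toReal_nonneg)
    have h2 := mul_le_mul_of_nonneg_left (hlog i) (hxpos i).le
    have h3 := mul_le_mul_of_nonneg_left (add_le_add h1 h2) (hA.weight_pos i).le
    linarith
  have hfinal := Finset.sum_le_sum fun i (_ : i ∈ Finset.univ) => hterm i
  rw [Finset.sum_add_distrib, ← Finset.mul_sum, ← Finset.sum_mul, ← hXdef] at hfinal
  have hCD := mul_le_mul_of_nonneg_left hDsum hC0
  rw [hent, hX]
  linarith

/-! ### Hypercontractivity -/

/-- Jensen's inequality for a Markov kernel. -/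
theorem MarkovSemigroup.rpow_act_le (P : MarkovSemigroup E) (t : ℝ≥0) {f : E → ℝ}
    (hf : Measurable f) {a b : ℝ} (ha : 0 ≤ a) (hab : ∀ x, f x ∈ Set.Icc a b) {p : ℝ}
    (hp : 1 ≤ p) (x : E) : P.act t f x ^ p ≤ P.act t (fun y => f y ^ p) x := by
  refine (convexOn_rpow hp).map_integral_le (μ := P.kernel t x)
    (continuousOn_id.rpow_const fun _ _ => Or.inr (by linarith)) isClosed_Ici
    (ae_of_all _ fun y => ha.trans (hab y).1) (integrable_of_mem_Icc hf hab) ?_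
  exact integrable_of_mem_Icc (a := 0) (b := b ^ p) (hf.pow_const p) fun y =>
    ⟨Real.rpow_nonneg (ha.trans (hab y).1) p,
      Real.rpow_le_rpow (ha.trans (hab y).1) (hab y).2 (by linarith)⟩

theorem MarkovSemigroup.integral_act_sq {P : MarkovSemigroup E} {π : Measure E}
    [IsProbabilityMeasure π] (hr : P.IsReversible π) (h : ℝ≥0) {f : E → ℝ} (hf : Measurable f)
    {a b : ℝ} (hab : ∀ x, f x ∈ Set.Icc a b) :
    ∫ x, P.act h f x ^ 2 ∂π = ∫ x, f x * P.act (2 * h) f x ∂π := by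
  have h1 := MarkovSemigroup.integral_mul_act_comm hr h (P.measurable_act h hf)
    (P.act_mem_Icc h hf hab) hf hab
  rw [P.act_act h h hf hab, ← two_mul] at h1
  simpa only [sq] using h1

theorem MarkovSemigroup.integral_mul_act_le_integral_sq {P : MarkovSemigroup E} {π : Measure E}
    (hP : P.IsStationary π) (hr : P.IsReversible π) (h : ℝ≥0) {f : E → ℝ} (hf : Measurable f)
    {a b : ℝ} (ha : 0 ≤ a) (hab : ∀ x, f x ∈ Set.Icc a b) :
    ∫ x, f x * P.act (2 * h) f x ∂π ≤ ∫ x, f x ^ 2 ∂π := by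
  have := hP.isProb
  rw [← P.integral_act_sq hr h hf hab]
  have hm : Measurable fun x => f x ^ 2 := hf.pow_const 2
  have hb : ∀ x, f x ^ 2 ∈ Set.Icc (a ^ 2) (b ^ 2) := fun x =>
    ⟨pow_le_pow_left₀ ha (hab x).1 2, pow_le_pow_left₀ (ha.trans (hab x).1) (hab x).2 2⟩
  have hb' : ∀ x, P.act h f x ^ 2 ∈ Set.Icc (a ^ 2) (b ^ 2) := fun x =>
    have h1 := P.act_mem_Icc h hf hab x
    ⟨pow_le_pow_left₀ ha h1.1 2, pow_le_pow_left₀ (ha.trans h1.1) h1.2 2⟩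
  rw [← hP.integral_act h hm hb]
  refine integral_mono (integrable_of_mem_Icc ((P.measurable_act h hf).pow_const 2) hb')
    (integrable_of_mem_Icc (P.measurable_act h hm) (P.act_mem_Icc h hm hb)) fun x => ?_
  simpa using P.rpow_act_le h hf ha hab (p := 2) (by norm_num) x

theorem rpow_mem_Icc {a b y p : ℝ} (ha : 0 < a) (hp : 0 ≤ p) (hy : y ∈ Set.Icc a b) :
    y ^ p ∈ Set.Icc (a ^ p) (b ^ p) :=
  ⟨Real.rpow_le_rpow ha.le hy.1 hp, Real.rpow_le_rpow (ha.le.trans hy.1) hy.2 hp⟩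

theorem rpow_mul_log_integrable {π : Measure E} [IsProbabilityMeasure π] {v : E → ℝ}
    (hv : Measurable v) {a b : ℝ} (ha : 0 < a) (hab : ∀ x, v x ∈ Set.Icc a b) {p : ℝ}
    (hp : 0 ≤ p) : Integrable (fun x => v x ^ p * Real.log (v x)) π := by
  have h1 : ∀ x, Real.log (v x) ∈ Set.Icc (Real.log a) (Real.log b) := fun x =>
    ⟨Real.log_le_log ha (hab x).1, Real.log_le_log (ha.trans_le (hab x).1) (hab x).2⟩
  refine Integrable.bdd_mul (c := b ^ p) (integrable_of_mem_Icc hv.log h1)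
    (hv.pow_const p).aestronglyMeasurable (ae_of_all _ fun x => ?_)
  have h2 := rpow_mem_Icc ha hp (hab x)
  rw [Real.norm_eq_abs, abs_of_nonneg ((Real.rpow_nonneg ha.le p).trans h2.1)]
  exact h2.2

theorem integral_rpow_pos {π : Measure E} [IsProbabilityMeasure π] {v : E → ℝ}
    (hv : Measurable v) {a b : ℝ} (ha : 0 < a) (hab : ∀ x, v x ∈ Set.Icc a b) {p : ℝ}
    (hp : 0 ≤ p) : 0 < ∫ x, v x ^ p ∂π := by
  have h1 := integral_mono (μ := π) (integrable_const (a ^ p))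
    (integrable_of_mem_Icc (hv.pow_const p) fun x => rpow_mem_Icc ha hp (hab x))
    fun x => (rpow_mem_Icc ha hp (hab x)).1
  simp only [integral_const, probReal_univ, one_smul] at h1
  exact lt_of_lt_of_le (by positivity) h1

/-- `p ↦ log π(v^p)` lies above its tangent at `p'`. -/
theorem log_integral_rpow_le {π : Measure E} [IsProbabilityMeasure π] {v : E → ℝ}
    (hv : Measurable v) {a b : ℝ} (ha : 0 < a) (hab : ∀ x, v x ∈ Set.Icc a b) {p p' : ℝ}
    (hp : 0 ≤ p) (hp' : 0 ≤ p') :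
    Real.log (∫ x, v x ^ p' ∂π) ≤ Real.log (∫ x, v x ^ p ∂π)
      + (p' - p) * ((∫ x, v x ^ p' * Real.log (v x) ∂π) / ∫ x, v x ^ p' ∂π) := by
  have hG := integral_rpow_pos (π := π) hv ha hab hp'
  have hi : Integrable (fun x => v x ^ p') π :=
    integrable_of_mem_Icc (hv.pow_const p') fun x => rpow_mem_Icc ha hp' (hab x)
  have hi' : Integrable (fun x => v x ^ p) π :=
    integrable_of_mem_Icc (hv.pow_const p) fun x => rpow_mem_Icc ha hp (hab x)
  have hl := rpow_mul_log_integrable (π := π) hv ha hab hp'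
  set G := ∫ x, v x ^ p' ∂π
  set S := ∫ x, v x ^ p' * Real.log (v x) ∂π
  set θ := (p' - p) * (S / G) with hθ
  have hpt : ∀ x, Real.exp (-θ) * ((1 + θ) * v x ^ p' - (p' - p) * (v x ^ p' * Real.log (v x)))
      ≤ v x ^ p := by
    intro x
    have hvx := ha.trans_le (hab x).1
    have h1 : v x ^ p = v x ^ p' * (Real.exp (-θ) * Real.exp (θ - (p' - p) * Real.log (v x))) := by
      rw [← Real.exp_add, Real.rpow_def_of_pos hvx, Real.rpow_def_of_pos hvx, ← Real.exp_add]
      congr 1; ring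
    have h2 := Real.add_one_le_exp (θ - (p' - p) * Real.log (v x))
    have h3 : 0 ≤ v x ^ p' * Real.exp (-θ) := by positivity
    have h4 := mul_le_mul_of_nonneg_left h2 h3
    rw [h1]
    linarith
  have h5 := integral_mono (((hi.const_mul (1 + θ)).sub (hl.const_mul (p' - p))).const_mul
    (Real.exp (-θ))) hi' hpt
  rw [integral_const_mul, integral_sub' (hi.const_mul _) (hl.const_mul _), integral_const_mul,
    integral_const_mul] at h5
  have h6 : (1 + θ) * G - (p' - p) * S = G := by
    rw [hθ]; field_simp; ring
  rw [show (1 + θ) * ∫ x, v x ^ p' ∂π = (1 + θ) * G from rfl,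
    show (p' - p) * ∫ x, v x ^ p' * Real.log (v x) ∂π = (p' - p) * S from rfl, h6] at h5
  have h7 := Real.log_le_log (by positivity) h5
  rw [Real.log_mul (Real.exp_pos _).ne' hG.ne', Real.log_exp] at h7
  linarith

/-- The dissipation of the `q`-th moment over a short time is at least that of the square of
`w = u^{q/2}`, because `(P^h u)^{q/2} ≤ P^h w`. -/
theorem MarkovSemigroup.integral_rpow_act_le {P : MarkovSemigroup E} {π : Measure E}
    [IsProbabilityMeasure π] (hr : P.IsReversible π) (h : ℝ≥0) {u : E → ℝ} (hu : Measurable u)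
    {a b : ℝ} (ha : 0 < a) (hab : ∀ x, u x ∈ Set.Icc a b) {q : ℝ} (hq : 2 ≤ q) :
    ∫ x, P.act h u x ^ q ∂π ≤ ∫ x, u x ^ q ∂π
      - ∫ x, u x ^ (q / 2) * (u x ^ (q / 2) - P.act (2 * h) (fun y => u y ^ (q / 2)) x) ∂π := by
  have hw : Measurable fun y => u y ^ (q / 2) := hu.pow_const _
  have hwb : ∀ x, u x ^ (q / 2) ∈ Set.Icc (a ^ (q / 2)) (b ^ (q / 2)) := fun x =>
    rpow_mem_Icc ha (by linarith) (hab x)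
  have hsq : ∀ y : ℝ, 0 ≤ y → (y ^ (q / 2)) ^ 2 = y ^ q := fun y hy => by
    rw [← Real.rpow_natCast, ← Real.rpow_mul hy]; congr 1; push_cast; ring
  have hpos : ∀ x, 0 ≤ u x := fun x => ha.le.trans (hab x).1
  have hact := P.act_mem_Icc h hu hab
  have hactw := P.act_mem_Icc h hw hwb
  have haq : 0 < a ^ (q / 2) := by positivity
  have h1 : ∫ x, P.act h u x ^ q ∂π ≤ ∫ x, P.act h (fun y => u y ^ (q / 2)) x ^ 2 ∂π := by
    refine integral_mono (integrable_of_mem_Icc ((P.measurable_act h hu).pow_const q)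
      fun x => rpow_mem_Icc ha (by linarith) (hact x))
      (integrable_of_mem_Icc (a := (a ^ (q / 2)) ^ 2) (b := (b ^ (q / 2)) ^ 2)
        ((P.measurable_act h hw).pow_const 2) fun x =>
          ⟨pow_le_pow_left₀ haq.le (hactw x).1 2,
            pow_le_pow_left₀ (haq.le.trans (hactw x).1) (hactw x).2 2⟩) fun x => ?_
    change P.act h u x ^ q ≤ _
    rw [← hsq _ (ha.le.trans (hact x).1)]
    exact pow_le_pow_left₀ (Real.rpow_nonneg (ha.le.trans (hact x).1) _)
      (P.rpow_act_le h hu ha.le hab (by linarith) x) 2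
  rw [P.integral_act_sq hr h hw hwb] at h1
  have hi1 : Integrable (fun x => u x ^ q) π :=
    integrable_of_mem_Icc (hu.pow_const q) fun x => rpow_mem_Icc ha (by linarith) (hab x)
  have hi2 : Integrable (fun x => u x ^ (q / 2) * P.act (2 * h) (fun y => u y ^ (q / 2)) x) π := by
    refine Integrable.bdd_mul (c := b ^ (q / 2)) (integrable_of_mem_Icc
      (P.measurable_act _ hw) (P.act_mem_Icc _ hw hwb)) hw.aestronglyMeasurable
      (ae_of_all _ fun x => ?_)
    rw [Real.norm_eq_abs, abs_of_nonneg (haq.le.trans (hwb x).1)]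
    exact (hwb x).2
  have h2 : ∫ x, u x ^ (q / 2) * (u x ^ (q / 2) - P.act (2 * h) (fun y => u y ^ (q / 2)) x) ∂π
      = ∫ x, u x ^ q ∂π - ∫ x, u x ^ (q / 2) * P.act (2 * h) (fun y => u y ^ (q / 2)) x ∂π := by
    rw [← integral_sub hi1 hi2]
    refine integral_congr_ae (ae_of_all _ fun x => ?_)
    simp only
    rw [← hsq _ (hpos x)]
    ring
  rw [h2]
  linarith

/-- The exponent `q(z) = 2 e^{2z/C}` along which the norms of `P^z f` are compared. -/
def hyperExponent (C z : ℝ) : ℝ := 2 * Real.exp (2 * z / C)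

theorem two_le_hyperExponent {C z : ℝ} (hC : 0 < C) (hz : 0 ≤ z) : 2 ≤ hyperExponent C z := by
  have : 1 ≤ Real.exp (2 * z / C) := Real.one_le_exp (by positivity)
  unfold hyperExponent; linarith

theorem hasDerivAt_hyperExponent (C z : ℝ) :
    HasDerivAt (hyperExponent C) (2 / C * hyperExponent C z) z := by
  have h1 : HasDerivAt (fun z : ℝ => 2 * z / C) (2 / C) z := by
    simpa using ((hasDerivAt_id z).const_mul 2).div_const C
  have h2 := (h1.exp).const_mul 2
  exact h2.congr_deriv (by simp only [hyperExponent]; ring)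

theorem continuous_hyperExponent (C : ℝ) : Continuous (hyperExponent C) :=
  continuous_iff_continuousAt.2 fun z => (hasDerivAt_hyperExponent C z).continuousAt

section Flow

variable {P : MarkovSemigroup E} {π : Measure E} {f : E → ℝ} {a b C L : ℝ}

theorem MarkovSemigroup.IsStationary.continuousWithinAt_integral_flow (hP : P.IsStationary π)
    (hf : Measurable f) (hab : ∀ x, f x ∈ Set.Icc a b) {T s : ℝ} (hs : s ∈ Set.Icc 0 T)
    {F : ℝ × ℝ → ℝ} (hF : ContinuousOn F (Set.Icc 0 T ×ˢ Set.Icc a b))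
    (hFm : ∀ z, Measurable fun y => F (z, y)) :
    ContinuousWithinAt (fun z : ℝ => ∫ x, F (z, P.act z.toNNReal f x) ∂π) (Set.Icc 0 T) s := by
  have := hP.isProb
  refine continuousWithinAt_integral_comp (u := fun z => P.act z.toNNReal f)
    (fun z => P.measurable_act _ hf) (fun z => P.act_mem_Icc _ hf hab) hF hFm hs ?_
  exact (hP.tendsto_integral_abs_act_sub_act hf hab s.toNNReal).comp
    ((continuous_real_toNNReal.tendsto s).mono_left nhdsWithin_le_nhds)

theorem continuousOn_rpow_hyperExponent (ha : 0 < a) (T : ℝ) :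
    ContinuousOn (fun p : ℝ × ℝ => p.2 ^ hyperExponent C p.1)
      (Set.Icc 0 T ×ˢ Set.Icc a b) :=
  continuousOn_snd.rpow ((continuous_hyperExponent C).comp continuous_fst).continuousOn
    fun _ hp => Or.inl (ha.trans_le hp.2.1).ne'

theorem continuousOn_rpow_mul_log_hyperExponent (ha : 0 < a) (T : ℝ) :
    ContinuousOn (fun p : ℝ × ℝ => p.2 ^ hyperExponent C p.1 * Real.log p.2)
      (Set.Icc 0 T ×ˢ Set.Icc a b) :=
  (continuousOn_rpow_hyperExponent ha T).mul
    (continuousOn_snd.log fun _ hp => (ha.trans_le hp.2.1).ne')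

/-- Every number below the Dirichlet form is a lower bound for the difference quotients at small
times. Negative numbers are always lower bounds, as the quotients are nonnegative. -/
theorem eventually_le_of_lt_dirichletForm (hP : P.IsStationary π) (hr : P.IsReversible π)
    {w : E → ℝ} (hw : Measurable w) (ha : 0 ≤ a) (hab : ∀ x, w x ∈ Set.Icc a b) {e : ℝ}
    (he : 0 ≤ e → ENNReal.ofReal e < P.dirichletForm π w) :
    ∀ᶠ t : ℝ≥0 in 𝓝[>] 0, e * t ≤ ∫ x, w x * (w x - P.act t w x) ∂π := by
  have := hP.isProb
  rcases le_or_gt 0 e with h0 | h0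
  · filter_upwards [eventually_lt_of_lt_liminf (he h0), self_mem_nhdsWithin] with t ht ht0
    have ht0' : (0 : ℝ) < t := ht0
    have := (ENNReal.ofReal_lt_ofReal_iff_of_nonneg h0).1 ht
    exact ((lt_div_iff₀ ht0').1 this).le
  · filter_upwards with t
    have h1 := MarkovSemigroup.integral_mul_act_le_integral_sq hP hr (t / 2) hw ha hab
    rw [mul_div_cancel₀ t (two_ne_zero)] at h1
    have hb0 : ∀ x, ‖w x‖ ≤ b := fun x => by
      rw [Real.norm_eq_abs, abs_of_nonneg (ha.trans (hab x).1)]; exact (hab x).2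
    have hi1 : Integrable (fun x => w x * w x) π :=
      Integrable.bdd_mul (integrable_of_mem_Icc hw hab) hw.aestronglyMeasurable (ae_of_all _ hb0)
    have hi2 : Integrable (fun x => w x * P.act t w x) π :=
      Integrable.bdd_mul (integrable_of_mem_Icc (P.measurable_act t hw) (P.act_mem_Icc t hw hab))
        hw.aestronglyMeasurable (ae_of_all _ hb0)
    simp only [mul_sub, sq] at h1 ⊢
    rw [integral_sub hi1 hi2]
    have := mul_nonneg (neg_nonneg.2 h0.le) t.coe_nonneg
    linarith

/-- The function `log ‖P^z f‖_{q(z)} + L / q(z)` of time, which decreases along the flow. The time is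
a real number `z ≥ 0`. -/
def hyperFunctional (P : MarkovSemigroup E) (π : Measure E) (f : E → ℝ) (C L z : ℝ) : ℝ :=
  (Real.log (∫ x, P.act z.toNNReal f x ^ hyperExponent C z ∂π) + L) / hyperExponent C z

/-- The infinitesimal form of hypercontractivity. Raising the exponent costs an entropy, which
the defective log-Sobolev inequality bounds by the dissipation of the flow. -/
theorem eventually_slope_hyperFunctional_lt (hP : P.IsStationary π) (hr : P.IsReversible π)
    (hC : 0 < C) (hLS : DefectiveLogSobolev P π C L) (hf : Measurable f) (ha : 0 < a)
    (hab : ∀ x, f x ∈ Set.Icc a b) {T s : ℝ} (hs : s ∈ Set.Ico 0 T) {r : ℝ} (hr0 : 0 < r) :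
    ∀ᶠ z in 𝓝[>] s, slope (hyperFunctional P π f C L) s z < r := by
  have := hP.isProb
  set u := P.act s.toNNReal f with hu
  have hum : Measurable u := P.measurable_act _ hf
  have hub : ∀ x, u x ∈ Set.Icc a b := P.act_mem_Icc _ hf hab
  set q := hyperExponent C s with hq
  have hq2 : 2 ≤ q := two_le_hyperExponent hC hs.1
  set w : E → ℝ := fun y => u y ^ (q / 2) with hw
  have hwm : Measurable w := hum.pow_const _
  have hwb : ∀ x, w x ∈ Set.Icc (a ^ (q / 2)) (b ^ (q / 2)) := fun x =>
    rpow_mem_Icc ha (by linarith) (hub x)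
  have hwsq : ∀ x, w x ^ 2 = u x ^ q := fun x => by
    rw [hw, ← Real.rpow_natCast, ← Real.rpow_mul (ha.le.trans (hub x).1)]
    congr 1; push_cast; ring
  set G : ℝ → ℝ := fun z => ∫ x, P.act z.toNNReal f x ^ hyperExponent C z ∂π with hG
  set S : ℝ → ℝ := fun z =>
    ∫ x, P.act z.toNNReal f x ^ hyperExponent C z * Real.log (P.act z.toNNReal f x) ∂π with hS
  have hGpos : ∀ z, 0 ≤ z → 0 < G z := fun z hz =>
    integral_rpow_pos (P.measurable_act _ hf) ha (P.act_mem_Icc _ hf hab)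
      (by linarith [two_le_hyperExponent hC hz])
  have hsI : s ∈ Set.Icc 0 T := Set.Ico_subset_Icc_self hs
  have hnhds : 𝓝[>] s ≤ 𝓝[Set.Icc 0 T] s := by
    exact le_inf nhdsWithin_le_nhds (le_principal_iff.2 (Icc_mem_nhdsGT_of_mem hs))
  have hGlim : Tendsto G (𝓝[>] s) (𝓝 (G s)) :=
    (hP.continuousWithinAt_integral_flow hf hab hsI (continuousOn_rpow_hyperExponent ha T)
      fun z => ((measurable_id (α := ℝ)).pow_const (hyperExponent C z) :)).mono_left hnhds
  have hSlim : Tendsto S (𝓝[>] s) (𝓝 (S s)) :=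
    (hP.continuousWithinAt_integral_flow hf hab hsI
      (continuousOn_rpow_mul_log_hyperExponent ha T)
      fun z => (((measurable_id (α := ℝ)).pow_const (hyperExponent C z)).mul Real.measurable_log :)).mono_left hnhds
  set A := G s with hA
  have hApos : 0 < A := hGpos s hs.1
  have hent : entropy π (fun x => w x ^ 2) = q * S s - A * Real.log A := by
    simp only [entropy, hwsq]
    congr 1
    rw [hS, ← integral_const_mul]
    refine integral_congr_ae (ae_of_all _ fun x => ?_)
    simp only [← hu, ← hq]
    rw [Real.log_rpow (ha.trans_le (hub x).1)]
    ring
  -- A lower bound `e` for the dissipation that is sharp up to the available error.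
  obtain ⟨e, he, heE⟩ : ∃ e : ℝ, (0 ≤ e → ENNReal.ofReal e < P.dirichletForm π w) ∧
      entropy π (fun x => w x ^ 2) - L * A - C * e < C * (r * q * A / 2) := by
    by_cases hfin : P.dirichletForm π w = ∞
    · refine ⟨(entropy π (fun x => w x ^ 2) - L * A) / C, fun _ => hfin ▸ ENNReal.ofReal_lt_top, ?_⟩
      rw [mul_div_cancel₀ _ hC.ne', sub_self]
      have : 0 < q := by linarith
      positivity
    · have h1 := hLS w hwm _ _ (by positivity) hwb hfin
      have h2 : ∫ x, w x ^ 2 ∂π = A := by simp only [hwsq]; rfl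
      rw [h2] at h1
      have hq0 : 0 < q := by linarith
      have hrA : 0 < r * q * A := by positivity
      refine ⟨(P.dirichletForm π w).toReal - r * q * A / 4, fun h0 => ?_, ?_⟩
      · rw [ENNReal.ofReal_lt_iff_lt_toReal h0 hfin]
        linarith
      · have h3 : C * ((P.dirichletForm π w).toReal - r * q * A / 4)
            = C * (P.dirichletForm π w).toReal - C * (r * q * A / 2) / 2 := by ring
        rw [h3]
        have : 0 < C * (r * q * A / 2) := by positivity
        linarith
  have hdiss := eventually_le_of_lt_dirichletForm hP hr hwm (by positivity) hwb he
  have hshift : Tendsto (fun z : ℝ => 2 * (z - s).toNNReal) (𝓝[>] s) (𝓝[>] 0) := by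
    refine tendsto_nhdsWithin_iff.2 ⟨?_, ?_⟩
    · have : Continuous fun z : ℝ => 2 * (z - s).toNNReal := by fun_prop
      simpa using (this.tendsto s).mono_left (nhdsWithin_le_nhds (s := Set.Ioi s))
    · filter_upwards [self_mem_nhdsWithin] with z hz
      have : 0 < (z - s).toNNReal := Real.toNNReal_pos.2 (sub_pos.2 hz)
      exact mul_pos two_pos this
  have hqd := hasDerivAt_hyperExponent C s
  have hqslope : Tendsto (slope (hyperExponent C) s) (𝓝[>] s) (𝓝 (2 / C * q)) :=
    (hasDerivAt_iff_tendsto_slope.1 hqd).mono_left (nhdsWithin_mono _ fun z hz => ne_of_gt hz)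
  have hqlim : Tendsto (hyperExponent C) (𝓝[>] s) (𝓝 q) :=
    hqd.continuousAt.tendsto.mono_left nhdsWithin_le_nhds
  have hq0 : q ≠ 0 := by linarith
  -- The upper bound for the slope that the two one-sided estimates give, and its limit.
  have hlim : Tendsto (fun z => slope (hyperExponent C) s z / hyperExponent C z *
      (S z / G z - (Real.log A + L) / q) - 2 * e / (A * hyperExponent C z)) (𝓝[>] s)
      (𝓝 (2 / C * q / q * (S s / A - (Real.log A + L) / q) - 2 * e / (A * q))) :=
    ((hqslope.div hqlim hq0).mul ((hSlim.div hGlim hApos.ne').sub_const _)).sub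
      (tendsto_const_nhds.div (hqlim.const_mul A) (mul_ne_zero hApos.ne' hq0))
  have hlt : 2 / C * q / q * (S s / A - (Real.log A + L) / q) - 2 * e / (A * q) < r := by
    have h1 : 2 / C * q / q * (S s / A - (Real.log A + L) / q) - 2 * e / (A * q)
        = 2 / (C * q * A) * (entropy π (fun x => w x ^ 2) - L * A - C * e) := by
      rw [hent]; field_simp; ring
    have h2 : 0 < 2 / (C * q * A) := by
      have : 0 < q := by linarith
      positivity
    rw [h1]
    refine (mul_lt_mul_of_pos_left heE h2).trans_le (le_of_eq ?_)
    field_simp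
  filter_upwards [hlim.eventually (gt_mem_nhds hlt), hshift.eventually hdiss,
    self_mem_nhdsWithin] with z hz hz2 hzs
  refine lt_of_le_of_lt ?_ hz
  have hzs' : 0 < z - s := sub_pos.2 hzs
  have hz0 : 0 ≤ z := hs.1.trans (le_of_lt hzs)
  have hqz2 := two_le_hyperExponent hC hz0
  have hqz0 : 0 < hyperExponent C z := by linarith
  set v := P.act z.toNNReal f with hv
  have hv' : v = P.act (z - s).toNNReal u := by
    rw [hu, P.act_act _ _ hf hab, ← Real.toNNReal_add hs.1 hzs'.le]
    simp [hv]
  have hvm : Measurable v := P.measurable_act _ hf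
  have hvb : ∀ x, v x ∈ Set.Icc a b := P.act_mem_Icc _ hf hab
  have h1 := log_integral_rpow_le (π := π) hvm ha hvb (p := q) (p' := hyperExponent C z)
    (by linarith) (by linarith)
  have h2 := P.integral_rpow_act_le hr (z - s).toNNReal hum ha hub hq2
  rw [← hv'] at h2
  have hvq := integral_rpow_pos (π := π) hvm ha hvb (p := q) (by linarith)
  have h3 : Real.log (∫ x, v x ^ q ∂π) ≤ Real.log A - 2 * e * (z - s) / A := by
    have h4 := Real.log_le_sub_one_of_pos (div_pos hvq hApos)
    rw [Real.log_div hvq.ne' hApos.ne'] at h4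
    have h5 : ∫ x, v x ^ q ∂π ≤ A - 2 * e * (z - s) := by
      have h6 : ((2 * (z - s).toNNReal : ℝ≥0) : ℝ) = 2 * (z - s) := by
        rw [NNReal.coe_mul, Real.coe_toNNReal _ hzs'.le]; rfl
      rw [h6] at hz2
      have h7 : ∫ x, u x ^ q ∂π = A := rfl
      linarith
    have h6 : (∫ x, v x ^ q ∂π) / A ≤ 1 - 2 * e * (z - s) / A := by
      rw [div_le_iff₀ hApos]; field_simp; linarith
    linarith
  have h8 : hyperFunctional P π f C L z ≤
      (Real.log A - 2 * e * (z - s) / A + (hyperExponent C z - q) * (S z / G z) + L)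
        / hyperExponent C z := by
    unfold hyperFunctional
    gcongr
    exact h1.trans (by gcongr)
  have h9 : hyperFunctional P π f C L s = (Real.log A + L) / q := rfl
  rw [slope_def_field, slope_def_field, h9, div_le_iff₀ hzs', ← hq]
  refine (sub_le_sub_right h8 _).trans (le_of_eq ?_)
  have := hGpos z hz0
  field_simp
  ring

/-- Along the flow the exponent can grow as `2 e^{2t/C}`, at the price of the defect `L`. -/
theorem hyperFunctional_le (hP : P.IsStationary π) (hr : P.IsReversible π) (hC : 0 < C)
    (hLS : DefectiveLogSobolev P π C L) (hf : Measurable f) (ha : 0 < a)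
    (hab : ∀ x, f x ∈ Set.Icc a b) {T : ℝ} (hT : 0 ≤ T) :
    hyperFunctional P π f C L T ≤ hyperFunctional P π f C L 0 := by
  have := hP.isProb
  have hcont : ContinuousOn (hyperFunctional P π f C L) (Set.Icc 0 T) := by
    refine ContinuousOn.div ((ContinuousOn.log (fun s hs => ?_) fun s hs => ?_).add
      continuousOn_const) (continuous_hyperExponent C).continuousOn fun s hs => ?_
    · exact hP.continuousWithinAt_integral_flow hf hab hs (continuousOn_rpow_hyperExponent ha T)
        fun z => ((measurable_id (α := ℝ)).pow_const (hyperExponent C z) :)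
    · exact (integral_rpow_pos (P.measurable_act _ hf) ha (P.act_mem_Icc _ hf hab)
        (by linarith [two_le_hyperExponent hC hs.1])).ne'
    · linarith [two_le_hyperExponent hC hs.1]
  refine image_le_of_liminf_slope_right_le_deriv_boundary hcont
    (B := fun _ => hyperFunctional P π f C L 0) (B' := fun _ => 0) le_rfl continuousOn_const
    (fun x _ => hasDerivWithinAt_const _ _ _) (fun s hs r hr0 => ?_) ⟨hT, le_rfl⟩
  exact (eventually_slope_hyperFunctional_lt hP hr hC hLS hf ha hab hs hr0).frequently

end Flow

theorem integral_rpow_act_le_of_pos {P : MarkovSemigroup E} {π : Measure E} {f : E → ℝ}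
    {a b C L : ℝ} (hP : P.IsStationary π) (hr : P.IsReversible π)
    (hLS : ∀ C', 0 ≤ C' → C ≤ C' → DefectiveLogSobolev P π C' L) (hf : Measurable f)
    (ha : 0 < a) (hab : ∀ x, f x ∈ Set.Icc a b) {q : ℝ} (hq : 2 < q) {T : ℝ≥0} (hT : 0 < T)
    (hCT : C * Real.log (q / 2) ≤ 2 * T) :
    ∫ x, P.act T f x ^ q ∂π ≤ Real.exp L ^ (q / 2 - 1) * (∫ x, f x ^ 2 ∂π) ^ (q / 2) := by
  have := hP.isProb
  have hlog : 0 < Real.log (q / 2) := Real.log_pos (by linarith)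
  have hT' : (0 : ℝ) < T := hT
  have hC' : 0 < 2 * (T : ℝ) / Real.log (q / 2) := by positivity
  have h1 := hyperFunctional_le hP hr hC'
    (hLS _ hC'.le ((le_div_iff₀ hlog).2 hCT)) hf ha hab hT'.le
  have hq1 : hyperExponent (2 * (T : ℝ) / Real.log (q / 2)) T = q := by
    unfold hyperExponent
    rw [show 2 * (T : ℝ) / (2 * (T : ℝ) / Real.log (q / 2)) = Real.log (q / 2) by field_simp,
      Real.exp_log (by linarith)]
    ring
  have hq0 : hyperExponent (2 * (T : ℝ) / Real.log (q / 2)) 0 = 2 := by simp [hyperExponent]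
  have hG := integral_rpow_pos (π := π) (P.measurable_act T hf) ha (P.act_mem_Icc T hf hab)
    (p := q) (by linarith)
  have hF := integral_rpow_pos (π := π) hf ha hab (p := 2) (by norm_num)
  simp only [hyperFunctional, hq1, hq0, Real.toNNReal_coe, Real.toNNReal_zero, P.act_zero hf] at h1
  simp only [Real.rpow_two] at h1 hF
  rw [div_le_iff₀ (by linarith)] at h1
  rw [← Real.log_le_log_iff hG (by positivity), Real.log_mul (by positivity) (by positivity),
    Real.log_rpow (Real.exp_pos _), Real.log_rpow hF, Real.log_exp]
  linarith

theorem integral_rpow_act_le_of_le {P : MarkovSemigroup E} {π : Measure E} {f : E → ℝ}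
    {a b C L : ℝ} (hP : P.IsStationary π) (hr : P.IsReversible π)
    (hLS : ∀ C', 0 ≤ C' → C ≤ C' → DefectiveLogSobolev P π C' L) (hf : Measurable f)
    (ha : 0 < a) (hab : ∀ x, f x ∈ Set.Icc a b) {q : ℝ} (hq : 2 < q) {T : ℝ≥0}
    (hCT : C * Real.log (q / 2) ≤ 2 * T) :
    ∫ x, P.act T f x ^ q ∂π ≤ Real.exp L ^ (q / 2 - 1) * (∫ x, f x ^ 2 ∂π) ^ (q / 2) := by
  rcases eq_or_lt_of_le (zero_le (a := T)) with rfl | hT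
  swap
  · exact integral_rpow_act_le_of_pos hP hr hLS hf ha hab hq hT hCT
  -- At time `0` the hypothesis forces `C ≤ 0`, so that the bound holds at all positive times.
  have hlim := hP.continuousWithinAt_integral_flow hf hab (T := 1) (s := 0)
    ⟨le_rfl, zero_le_one⟩ (F := fun p => p.2 ^ q)
    (continuousOn_snd.rpow_const fun _ hp => Or.inl (ha.trans_le hp.2.1).ne')
    fun z => ((measurable_id (α := ℝ)).pow_const q :)
  have hnhds : 𝓝[>] (0 : ℝ) ≤ 𝓝[Set.Icc 0 1] 0 :=
    le_inf nhdsWithin_le_nhds (le_principal_iff.2 (Icc_mem_nhdsGT_of_mem ⟨le_rfl, one_pos⟩))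
  have h1 := hlim.mono_left hnhds
  simp only [Real.toNNReal_zero] at h1
  refine le_of_tendsto h1 ?_
  filter_upwards [self_mem_nhdsWithin] with z hz
  refine integral_rpow_act_le_of_pos hP hr hLS hf ha hab hq (Real.toNNReal_pos.2 hz)
    (hCT.trans ?_)
  simp

/-! ### Markov kernels acting on nonnegative functions -/

/-- The action of a kernel on a function with values in `[0, ∞]`. -/
def lact (K : Kernel E E) (f : E → ℝ≥0∞) (x : E) : ℝ≥0∞ := ∫⁻ y, f y ∂K x

theorem measurable_lact (K : Kernel E E) {f : E → ℝ≥0∞} (hf : Measurable f) :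
    Measurable (lact K f) := hf.lintegral_kernel

theorem lact_mono (K : Kernel E E) {f g : E → ℝ≥0∞} (h : ∀ x, f x ≤ g x) (x : E) :
    lact K f x ≤ lact K g x := lintegral_mono h

/-- A bound for the truncations of `f` is a bound for `f`. -/
theorem lintegral_lact_rpow_le_of_truncation {K : Kernel E E} {π : Measure E} {f : E → ℝ≥0∞}
    (hf : Measurable f) {p : ℝ} (hp : 0 ≤ p) {c : ℝ≥0∞}
    (h : ∀ n : ℕ, ∫⁻ x, lact K (fun y => min (f y) n) x ^ p ∂π ≤ c) :
    ∫⁻ x, lact K f x ^ p ∂π ≤ c := by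
  have hmono : ∀ y, Monotone fun n : ℕ => min (f y) n := fun y m n hmn =>
    min_le_min_left _ (Nat.cast_le.2 hmn)
  have hlim : ∀ y, Tendsto (fun n : ℕ => min (f y) n) atTop (𝓝 (f y)) := fun y => by
    simpa using (tendsto_const_nhds (x := f y)).min ENNReal.tendsto_nat_nhds_top
  have hm : ∀ n : ℕ, Measurable fun y => min (f y) (n : ℝ≥0∞) := fun n =>
    hf.min measurable_const
  refine le_of_tendsto' (lintegral_tendsto_of_tendsto_of_monotone
    (fun n => ((measurable_lact K (hm n)).pow_const p).aemeasurable)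
    (ae_of_all _ fun x m n hmn => ?_) (ae_of_all _ fun x => ?_)) h
  · exact ENNReal.rpow_le_rpow (lact_mono K (fun y => hmono y hmn) x) hp
  · refine (ENNReal.continuous_rpow_const.tendsto _).comp ?_
    exact lintegral_tendsto_of_tendsto_of_monotone (fun n => (hm n).aemeasurable)
      (ae_of_all _ fun y => hmono y) (ae_of_all _ hlim)

theorem lact_ofReal (P : MarkovSemigroup E) (T : ℝ≥0) {f : E → ℝ} (hf : Measurable f) {a b : ℝ}
    (ha : 0 ≤ a) (hab : ∀ x, f x ∈ Set.Icc a b) (x : E) :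
    lact (P.kernel T) (fun y => ENNReal.ofReal (f y)) x = ENNReal.ofReal (P.act T f x) :=
  (ofReal_integral_eq_lintegral_ofReal (integrable_of_mem_Icc hf hab)
    (ae_of_all _ fun y => ha.trans (hab y).1)).symm

theorem lintegral_ofReal_rpow {π : Measure E} [IsProbabilityMeasure π] {v : E → ℝ}
    (hv : Measurable v) {a b : ℝ} (ha : 0 < a) (hab : ∀ x, v x ∈ Set.Icc a b) {p : ℝ}
    (hp : 0 ≤ p) :
    ∫⁻ x, ENNReal.ofReal (v x) ^ p ∂π = ENNReal.ofReal (∫ x, v x ^ p ∂π) := by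
  rw [ofReal_integral_eq_lintegral_ofReal (integrable_of_mem_Icc (hv.pow_const p)
    fun x => rpow_mem_Icc ha hp (hab x))
    (ae_of_all _ fun y => Real.rpow_nonneg (ha.le.trans (hab y).1) p)]
  exact lintegral_congr fun x => ENNReal.ofReal_rpow_of_nonneg (ha.le.trans (hab x).1) hp

/-- Hypercontractivity: `‖P^T f‖_q ≤ e^{L (1/2 - 1/q)} ‖f‖_2` as soon as `C log (q/2) ≤ 2 T`. -/
theorem lintegral_lact_rpow_le {P : MarkovSemigroup E} {π : Measure E}
    {C L : ℝ} (hP : P.IsStationary π) (hr : P.IsReversible π)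
    (hLS : ∀ C', 0 ≤ C' → C ≤ C' → DefectiveLogSobolev P π C' L) {f : E → ℝ≥0∞}
    (hf : Measurable f) {q : ℝ} (hq : 2 < q) {T : ℝ≥0}
    (hCT : C * Real.log (q / 2) ≤ 2 * T) :
    ∫⁻ x, lact (P.kernel T) f x ^ q ∂π
      ≤ ENNReal.ofReal (Real.exp L) ^ (q / 2 - 1) * (∫⁻ x, f x ^ (2 : ℝ) ∂π) ^ (q / 2) := by
  have := hP.isProb
  set I := ∫⁻ x, f x ^ (2 : ℝ) ∂π with hI
  have hq0 : 0 ≤ q := by linarith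
  refine lintegral_lact_rpow_le_of_truncation hf hq0 fun m => ?_
  -- A truncated function is raised by `δ n` so as to be bounded away from zero.
  set δ : ℕ → ℝ := fun n => 1 / ((n : ℝ) + 1) with hδ
  have hδ0 : ∀ n, 0 < δ n := fun n => by positivity
  have hbound : ∀ n : ℕ, m ≤ n → ∫⁻ x, lact (P.kernel T) (fun y => min (f y) m) x ^ q ∂π
      ≤ ENNReal.ofReal (Real.exp L) ^ (q / 2 - 1) *
        (I ^ (1 / 2 : ℝ) + ENNReal.ofReal (δ n)) ^ q := by
    intro n hmn
    set g : E → ℝ := fun x => (min (f x) n).toReal + δ n with hg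
    have hgm : Measurable g := (hf.min measurable_const).ennreal_toReal.add_const _
    have hgb : ∀ x, g x ∈ Set.Icc (δ n) (n + δ n) := fun x => by
      have h1 : (min (f x) (n : ℝ≥0∞)).toReal ≤ n := by
        simpa using ENNReal.toReal_mono (ENNReal.natCast_ne_top n) (min_le_right (f x) (n : ℝ≥0∞))
      have h2 : 0 ≤ (min (f x) (n : ℝ≥0∞)).toReal := ENNReal.toReal_nonneg
      simp only [hg, Set.mem_Icc]
      constructor <;> linarith
    have hgE : ∀ x, ENNReal.ofReal (g x) = min (f x) n + ENNReal.ofReal (δ n) := fun x => by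
      rw [hg, ENNReal.ofReal_add ENNReal.toReal_nonneg (hδ0 n).le, ENNReal.ofReal_toReal]
      exact ((min_le_right _ _).trans_lt (ENNReal.natCast_lt_top n)).ne
    have hmain := integral_rpow_act_le_of_le hP hr hLS hgm (hδ0 n) hgb hq hCT
    have hmain' := ENNReal.ofReal_le_ofReal hmain
    have hg2 := integral_rpow_pos (π := π) hgm (hδ0 n) hgb (p := 2) (by norm_num)
    have hg2' : ∫ x, g x ^ 2 ∂π = ∫ x, g x ^ (2 : ℝ) ∂π := by simp only [Real.rpow_two]
    rw [hg2', ← lintegral_ofReal_rpow (P.measurable_act T hgm) (hδ0 n) (P.act_mem_Icc T hgm hgb) hq0,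
      ENNReal.ofReal_mul (by positivity), ← ENNReal.ofReal_rpow_of_pos (Real.exp_pos _),
      ← ENNReal.ofReal_rpow_of_pos hg2, ← lintegral_ofReal_rpow hgm (hδ0 n) hgb (by norm_num)]
      at hmain'
    refine le_trans (lintegral_mono fun x => ENNReal.rpow_le_rpow ?_ hq0) (hmain'.trans ?_)
    · rw [← lact_ofReal P T hgm (hδ0 n).le hgb]
      refine lact_mono _ (fun y => ?_) x
      rw [hgE]
      exact le_trans (min_le_min_left _ (Nat.cast_le.2 hmn)) le_self_add
    · refine mul_le_mul_right ?_ _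
      have h1 := ENNReal.lintegral_Lp_add_le (μ := π) (p := 2) hf.aemeasurable
        (measurable_const (a := ENNReal.ofReal (δ n))).aemeasurable (by norm_num)
      simp only [Pi.add_apply, lintegral_const, measure_univ, mul_one] at h1
      rw [← ENNReal.rpow_mul, show (2 : ℝ) * (1 / 2) = 1 by norm_num, ENNReal.rpow_one] at h1
      have h2 : ∫⁻ x, ENNReal.ofReal (g x) ^ (2 : ℝ) ∂π
          ≤ ∫⁻ x, (f x + ENNReal.ofReal (δ n)) ^ (2 : ℝ) ∂π := by
        refine lintegral_mono fun x => ENNReal.rpow_le_rpow ?_ (by norm_num)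
        rw [hgE]
        gcongr
        exact min_le_left _ _
      calc (∫⁻ x, ENNReal.ofReal (g x) ^ (2 : ℝ) ∂π) ^ (q / 2)
          ≤ (∫⁻ x, (f x + ENNReal.ofReal (δ n)) ^ (2 : ℝ) ∂π) ^ (q / 2) :=
            ENNReal.rpow_le_rpow h2 (by linarith)
        _ = ((∫⁻ x, (f x + ENNReal.ofReal (δ n)) ^ (2 : ℝ) ∂π) ^ (1 / 2 : ℝ)) ^ q := by
            rw [← ENNReal.rpow_mul]; congr 1; ring
        _ ≤ _ := ENNReal.rpow_le_rpow h1 hq0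
  have hδlim : Tendsto (fun n => ENNReal.ofReal (δ n)) atTop (𝓝 0) := by
    simpa only [ENNReal.ofReal_zero] using ENNReal.tendsto_ofReal tendsto_one_div_add_atTop_nhds_zero_nat
  have hlim : Tendsto (fun n => ENNReal.ofReal (Real.exp L) ^ (q / 2 - 1) *
      (I ^ (1 / 2 : ℝ) + ENNReal.ofReal (δ n)) ^ q) atTop
      (𝓝 (ENNReal.ofReal (Real.exp L) ^ (q / 2 - 1) * (I ^ (1 / 2 : ℝ) + 0) ^ q)) := by
    refine ENNReal.Tendsto.const_mul ((ENNReal.continuous_rpow_const.tendsto _).comp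
      (tendsto_const_nhds.add hδlim)) (Or.inr ?_)
    exact ENNReal.rpow_ne_top_of_nonneg (by linarith) ENNReal.ofReal_ne_top
  rw [add_zero, ← ENNReal.rpow_mul, show (1 / 2 : ℝ) * q = q / 2 by ring] at hlim
  refine ge_of_tendsto hlim ?_
  filter_upwards [eventually_ge_atTop m] with n hn using hbound n hn

theorem lintegral_lact_sq {P : MarkovSemigroup E} {π : Measure E} [IsProbabilityMeasure π]
    (hr : P.IsReversible π) {f : E → ℝ≥0∞} (hf : Measurable f) (T : ℝ≥0) :
    ∫⁻ x, lact (P.kernel T) f x ^ (2 : ℝ) ∂π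
      = ∫⁻ x, f x * lact (P.kernel T) (lact (P.kernel T) f) x ∂π := by
  have h := lintegral_mul_kernel_comm (hr T) hf (measurable_lact (P.kernel T) hf)
  simp only [ENNReal.rpow_two, sq]
  exact h.symm

/-- The dual form of hypercontractivity: with `q'` the exponent conjugate to `q`,
`‖P^T f‖_2 ≤ e^{L (1/2 - 1/q)} ‖f‖_{q'}`. -/
theorem lintegral_lact_sq_le {P : MarkovSemigroup E} {π : Measure E}
    {C L : ℝ} (hP : P.IsStationary π) (hr : P.IsReversible π)
    (hLS : ∀ C', 0 ≤ C' → C ≤ C' → DefectiveLogSobolev P π C' L) {f : E → ℝ≥0∞}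
    (hf : Measurable f) {q q' : ℝ} (hq : 2 < q) (hqq : q'.HolderConjugate q) {T : ℝ≥0}
    (hCT : C * Real.log (q / 2) ≤ 2 * T) :
    ∫⁻ x, lact (P.kernel T) f x ^ (2 : ℝ) ∂π
      ≤ ENNReal.ofReal (Real.exp L) ^ (1 - 2 / q) * (∫⁻ x, f x ^ q' ∂π) ^ (2 / q') := by
  have := hP.isProb
  have hq'0 : 0 < q' := hqq.pos
  refine lintegral_lact_rpow_le_of_truncation hf (by norm_num) fun n => ?_
  set g : E → ℝ≥0∞ := fun y => min (f y) n with hg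
  have hgm : Measurable g := hf.min measurable_const
  set A := ∫⁻ x, lact (P.kernel T) g x ^ (2 : ℝ) ∂π with hA
  have hAtop : A ≠ ∞ := by
    have h1 : A ≤ ∫⁻ _, (n : ℝ≥0∞) ^ (2 : ℝ) ∂π := by
      refine lintegral_mono fun x => ENNReal.rpow_le_rpow ?_ (by norm_num)
      refine (lact_mono _ (fun y => min_le_right _ _) x).trans (le_of_eq ?_)
      simp [lact]
    refine ne_top_of_le_ne_top ?_ h1
    simp
  set W := ENNReal.ofReal (Real.exp L) with hW
  have hWtop : W ≠ ∞ := ENNReal.ofReal_ne_top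
  have hW0 : W ≠ 0 := by simp [hW, Real.exp_pos]
  have hmono : (∫⁻ x, g x ^ q' ∂π) ≤ ∫⁻ x, f x ^ q' ∂π :=
    lintegral_mono fun x => ENNReal.rpow_le_rpow (min_le_left _ _) hq'0.le
  have h2 : A ≤ (∫⁻ x, g x ^ q' ∂π) ^ (1 / q') * (W ^ (1 / 2 - 1 / q) * A ^ (1 / 2 : ℝ)) := by
    conv_lhs => rw [hA, lintegral_lact_sq hr hgm]
    refine (ENNReal.lintegral_mul_le_Lp_mul_Lq π hqq hgm.aemeasurable
      (measurable_lact _ (measurable_lact _ hgm)).aemeasurable).trans ?_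
    refine mul_le_mul_right ?_ _
    have h3 := lintegral_lact_rpow_le hP hr hLS (measurable_lact (P.kernel T) hgm) hq hCT
    refine (ENNReal.rpow_le_rpow h3 (by have := hqq.symm.pos; positivity)).trans (le_of_eq ?_)
    rw [ENNReal.mul_rpow_of_nonneg _ _ (by have := hqq.symm.pos; positivity), ← ENNReal.rpow_mul,
      ← ENNReal.rpow_mul]
    congr 2 <;> (field_simp)
  rcases eq_or_ne A 0 with hA0 | hA0
  · rw [hA0]; exact zero_le
  have hAs : A ^ (1 / 2 : ℝ) ≠ 0 := by simp [hA0, hAtop]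
  have hAs' : A ^ (1 / 2 : ℝ) ≠ ∞ := ENNReal.rpow_ne_top_of_nonneg (by norm_num) hAtop
  have h4 : A ^ (1 / 2 : ℝ) ≤ (∫⁻ x, g x ^ q' ∂π) ^ (1 / q') * W ^ (1 / 2 - 1 / q) := by
    rw [← ENNReal.mul_le_mul_iff_left hAs hAs', mul_assoc]
    refine le_trans (le_of_eq ?_) h2
    rw [← ENNReal.rpow_add_of_nonneg _ _ (by norm_num) (by norm_num)]
    norm_num
  have h5 := ENNReal.rpow_le_rpow h4 (z := 2) (by norm_num)
  rw [ENNReal.mul_rpow_of_nonneg _ _ (by norm_num), ← ENNReal.rpow_mul, ← ENNReal.rpow_mul,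
    ← ENNReal.rpow_mul, show (1 / 2 : ℝ) * 2 = 1 by norm_num, ENNReal.rpow_one, mul_comm] at h5
  refine h5.trans ?_
  rw [show (1 / 2 - 1 / q) * 2 = 1 - 2 / q by ring, show 1 / q' * 2 = 2 / q' by ring]
  gcongr

/-! ### Smoothing estimates at one level -/

/-- The smoothing properties of a mutation kernel `K` with invariant probability measure `π` on
which the error analysis rests: `π`-mean preservation, the norm bounds from `L²` to `L³`, from
`L^{3/2}` to `L²` and from `L^{3/2}` to `L³` in terms of `W = 1 / min w`, and, for functions of
mean one, a bound for the second moment that is nearly independent of the initial one. -/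
structure IsSmoothing (K : Kernel E E) (π : Measure E) (W : ℝ≥0∞) (γ : ℝ) : Prop where
  isProb : IsProbabilityMeasure π
  lintegral_lact : ∀ f : E → ℝ≥0∞, Measurable f → ∫⁻ x, lact K f x ∂π = ∫⁻ x, f x ∂π
  cube_le_sq : ∀ f : E → ℝ≥0∞, Measurable f →
    ∫⁻ x, lact K f x ^ (3 : ℝ) ∂π ≤ W ^ (1 / 2 : ℝ) * (∫⁻ x, f x ^ (2 : ℝ) ∂π) ^ (3 / 2 : ℝ)
  sq_le : ∀ f : E → ℝ≥0∞, Measurable f →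
    ∫⁻ x, lact K f x ^ (2 : ℝ) ∂π
      ≤ W ^ (1 / 3 : ℝ) * (∫⁻ x, f x ^ (3 / 2 : ℝ) ∂π) ^ (4 / 3 : ℝ)
  cube_le : ∀ f : E → ℝ≥0∞, Measurable f →
    ∫⁻ x, lact K f x ^ (3 : ℝ) ∂π ≤ W * (∫⁻ x, f x ^ (3 / 2 : ℝ) ∂π) ^ (2 : ℝ)
  sq_le_of_mean_one : ∀ f : E → ℝ≥0∞, Measurable f → ∫⁻ x, f x ∂π = 1 →
    ∫⁻ x, lact K f x ^ (2 : ℝ) ∂π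
      ≤ W ^ (1 - 1 / (1 + γ)) * (∫⁻ x, f x ^ (2 : ℝ) ∂π) ^ (1 / (1 + γ))

theorem MarkovSemigroup.lact_add (P : MarkovSemigroup E) (s t : ℝ≥0) {f : E → ℝ≥0∞}
    (hf : Measurable f) :
    lact (P.kernel (s + t)) f = lact (P.kernel t) (lact (P.kernel s) f) := by
  funext x
  rw [lact, P.kernel_add, Kernel.lintegral_comp _ _ _ hf]
  rfl

/-- Interpolation of the `p`-th moment between the first and the second. -/
theorem lintegral_rpow_le_interpolation {π : Measure E} {f : E → ℝ≥0∞} (hf : Measurable f)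
    {p : ℝ} (hp1 : 1 ≤ p) (hp2 : p ≤ 2) :
    ∫⁻ x, f x ^ p ∂π ≤ (∫⁻ x, f x ∂π) ^ (2 - p) * (∫⁻ x, f x ^ (2 : ℝ) ∂π) ^ (p - 1) := by
  have h := ENNReal.lintegral_mul_norm_pow_le (μ := π) hf.aemeasurable
    (hf.pow_const (2 : ℝ)).aemeasurable (p := 2 - p) (q := p - 1) (by linarith) (by linarith)
    (by ring)
  refine le_trans (le_of_eq (lintegral_congr fun x => ?_)) h
  rw [← ENNReal.rpow_mul, ← ENNReal.rpow_add_of_nonneg _ _ (by linarith) (by linarith)]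
  congr 1; ring

/-- The `L^{3/2}(π)` norm of a nonnegative function. -/
def norm32 (π : Measure E) (f : E → ℝ≥0∞) : ℝ≥0∞ := (∫⁻ x, f x ^ (3 / 2 : ℝ) ∂π) ^ (2 / 3 : ℝ)

theorem lintegral_le_norm32 {π : Measure E} [IsProbabilityMeasure π] {f : E → ℝ≥0∞}
    (hf : Measurable f) : ∫⁻ x, f x ∂π ≤ norm32 π f := by
  have h := ENNReal.lintegral_mul_norm_pow_le (μ := π)
    (hf.pow_const (3 / 2 : ℝ)).aemeasurable (aemeasurable_const (b := (1 : ℝ≥0∞)))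
    (p := 2 / 3) (q := 1 / 3) (by norm_num) (by norm_num) (by norm_num)
  simp only [ENNReal.one_rpow, mul_one, lintegral_const, measure_univ] at h
  refine le_trans (le_of_eq (lintegral_congr fun x => ?_)) h
  rw [← ENNReal.rpow_mul]; norm_num

/-- After a time `2 C γ^7` a reversible semigroup whose stationary distribution is a mixture of
components with log-Sobolev inequalities has the smoothing properties, although it need not be
close to equilibrium. -/
theorem LevelAssumption.isSmoothing {μ : Measure E} {P : MarkovSemigroup E} {m : ℕ}
    {w : Fin m → ℝ} {ν : Fin m → Measure E} {Q : Fin m → MarkovSemigroup E} {c : Fin m → ℝ}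
    (hA : LevelAssumption μ P w ν Q c) {C : ℝ} (hC : ∀ i, c i ≤ C) {wmin : ℝ}
    (hwmin : 0 < wmin) (hw : ∀ i, wmin ≤ w i) {γ : ℝ} (hγ : 1 ≤ γ) {T : ℝ≥0}
    (hT : 2 * C * γ ^ 7 ≤ T) :
    IsSmoothing (P.kernel T) μ (ENNReal.ofReal wmin⁻¹) γ := by
  have hLS : ∀ C', 0 ≤ C' → C ≤ C' → DefectiveLogSobolev P μ C' (-Real.log wmin) :=
    fun C' h0 h1 => hA.defectiveLogSobolev (fun i => (hC i).trans h1) hwmin hw h0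
  have hP := hA.stationary
  have hr := hA.reversible
  have hW : Real.exp (-Real.log wmin) = wmin⁻¹ := by rw [Real.exp_neg, Real.exp_log hwmin]
  have hprob := hP.isProb
  have hT0 : (0 : ℝ) ≤ T := T.coe_nonneg
  have hγ7 : γ ≤ γ ^ 7 := le_self_pow₀ hγ (by norm_num)
  have hlog : ∀ y : ℝ, 0 ≤ Real.log y → Real.log y ≤ γ → C * Real.log y ≤ T := by
    intro y h0 h1
    rcases le_or_gt C 0 with h | h
    · exact (mul_nonpos_of_nonpos_of_nonneg h h0).trans hT0
    · have h2 : C * Real.log y ≤ C * γ ^ 7 := by gcongr; exact h1.trans hγ7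
      have h3 : 0 ≤ C * γ ^ 7 := by positivity
      linarith
  have hlog3 : C * Real.log (3 / 2) ≤ T :=
    hlog _ (Real.log_nonneg (by norm_num))
      ((Real.log_le_sub_one_of_pos (by norm_num)).trans (by linarith))
  have hlogγ : C * Real.log (2 * (1 + γ) / 2) ≤ T := by
    refine hlog _ (Real.log_nonneg (by linarith))
      ((Real.log_le_sub_one_of_pos (by linarith)).trans (by linarith))
  have hconj : (3 / 2 : ℝ).HolderConjugate 3 :=
    Real.holderConjugate_iff.2 ⟨by norm_num, by norm_num⟩
  have hcube : ∀ (S : ℝ≥0), C * Real.log (3 / 2) ≤ 2 * S → ∀ f : E → ℝ≥0∞, Measurable f →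
      ∫⁻ x, lact (P.kernel S) f x ^ (3 : ℝ) ∂μ ≤ ENNReal.ofReal wmin⁻¹ ^ (1 / 2 : ℝ) *
        (∫⁻ x, f x ^ (2 : ℝ) ∂μ) ^ (3 / 2 : ℝ) := by
    intro S hS f hf
    have h := lintegral_lact_rpow_le hP hr hLS hf (q := 3) (by norm_num) hS
    rwa [hW, show (3 / 2 - 1 : ℝ) = 1 / 2 by norm_num] at h
  have hsq : ∀ (S : ℝ≥0), C * Real.log (3 / 2) ≤ 2 * S → ∀ f : E → ℝ≥0∞, Measurable f →
      ∫⁻ x, lact (P.kernel S) f x ^ (2 : ℝ) ∂μ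
        ≤ ENNReal.ofReal wmin⁻¹ ^ (1 / 3 : ℝ) *
          (∫⁻ x, f x ^ (3 / 2 : ℝ) ∂μ) ^ (4 / 3 : ℝ) := by
    intro S hS f hf
    have h := lintegral_lact_sq_le hP hr hLS hf (q := 3) (by norm_num) hconj hS
    rwa [hW, show (1 - 2 / 3 : ℝ) = 1 / 3 by norm_num,
      show (2 / (3 / 2) : ℝ) = 4 / 3 by norm_num] at h
  refine ⟨hprob, fun f hf => hP.lintegral_kernel T hf, hcube T (by linarith),
    hsq T (by linarith), fun f hf => ?_, fun f hf h1 => ?_⟩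
  · -- The two halves of the time interval lead from `L^{3/2}` to `L²` and from `L²` to `L³`.
    have hhalf : C * Real.log (3 / 2) ≤ 2 * ((T / 2 : ℝ≥0) : ℝ) := by
      push_cast; linarith
    have h1 := hcube (T / 2) hhalf _ (measurable_lact (P.kernel (T / 2)) hf)
    rw [← P.lact_add _ _ hf, add_halves] at h1
    refine h1.trans ?_
    refine (mul_le_mul_right (ENNReal.rpow_le_rpow (hsq (T / 2) hhalf f hf) (by norm_num)) _).trans
      (le_of_eq ?_)
    rw [ENNReal.mul_rpow_of_nonneg _ _ (by norm_num), ← ENNReal.rpow_mul, ← ENNReal.rpow_mul,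
      ← mul_assoc, ← ENNReal.rpow_add_of_nonneg _ _ (by norm_num) (by norm_num)]
    norm_num
  · -- The target exponent `q = 2 (1 + γ)` makes the conjugate one close to `1`.
    set q : ℝ := 2 * (1 + γ) with hq
    have hq2 : 2 < q := by linarith
    have hconj' : (q / (q - 1)).HolderConjugate q :=
      (Real.HolderConjugate.conjExponent (by linarith : 1 < q)).symm
    set q' : ℝ := q / (q - 1) with hq'
    have hq'1 : 1 ≤ q' := hconj'.lt.le
    have hq'2 : q' ≤ 2 := by rw [hq', div_le_iff₀ (by linarith)]; linarith
    have h2 := lintegral_lact_sq_le hP hr hLS hf hq2 hconj' (T := T) (by linarith)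
    have h3 := lintegral_rpow_le_interpolation (π := μ) hf hq'1 hq'2
    rw [h1, ENNReal.one_rpow, one_mul] at h3
    refine h2.trans ?_
    have h4 : 2 / q = 1 / (1 + γ) := by
      have : 1 + γ ≠ 0 := by linarith
      rw [hq]; field_simp
    rw [hW, h4]
    refine mul_le_mul_right ?_ _
    refine (ENNReal.rpow_le_rpow h3 (by positivity)).trans (le_of_eq ?_)
    rw [← ENNReal.rpow_mul]
    congr 1
    rw [← h4, hq']
    have h5 : q - 1 ≠ 0 := by linarith
    have h6 : q ≠ 0 := by linarith
    field_simp
    ring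

/-! ### Uniform bounds for the Feynman-Kac semigroup -/

/-- `Q_{j, j+d}`, where `(Q_{k, k+1} f)(x) = g_k(x) (K_{k+1} f)(x)`: it maps functions on level
`j + d` to functions on level `j`. -/
def feynmanKac (g : ℕ → E → ℝ≥0) (K : ℕ → Kernel E E) : ℕ → ℕ → (E → ℝ≥0∞) → E → ℝ≥0∞
  | _, 0, f => f
  | j, d + 1, f => fun x => g j x * lact (K (j + 1)) (feynmanKac g K (j + 1) d f) x

theorem measurable_feynmanKac {g : ℕ → E → ℝ≥0} (hg : ∀ k, Measurable (g k))
    (K : ℕ → Kernel E E) {f : E → ℝ≥0∞} (hf : Measurable f) (j d : ℕ) :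
    Measurable (feynmanKac g K j d f) := by
  induction d generalizing j with
  | zero => exact hf
  | succ d ih => exact (hg j).coe_nnreal_ennreal.mul (measurable_lact _ (ih (j + 1)))

/-- The levels `1, …, n` are linked by densities `g k ≤ γ`, and the mutation kernels are
smoothing. -/
structure SmoothingLevels (n : ℕ) (μ : ℕ → Measure E) (g : ℕ → E → ℝ≥0) (K : ℕ → Kernel E E)
    (W : ℝ≥0∞) (γ : ℝ) : Prop where
  measurable : ∀ k, Measurable (g k)
  one_le_bound : 1 ≤ γ
  one_le_mass : 1 ≤ W
  isProb : ∀ k, 1 ≤ k → k ≤ n → IsProbabilityMeasure (μ k)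
  density : ∀ k, 1 ≤ k → k < n → μ (k + 1) = (μ k).withDensity (fun x => (g k x : ℝ≥0∞))
  density_le : ∀ k, 1 ≤ k → k < n → ∀ᵐ x ∂(μ k), (g k x : ℝ) ≤ γ
  smoothing : ∀ k, 1 ≤ k → k < n → IsSmoothing (K (k + 1)) (μ (k + 1)) W γ

theorem pow_rpow_eq (x : ℝ≥0∞) {n m : ℕ} {r : ℝ} (h : (n : ℝ) * r = m) : (x ^ n) ^ r = x ^ m := by
  rw [← ENNReal.rpow_natCast, ← ENNReal.rpow_mul, h, ENNReal.rpow_natCast]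

theorem exists_pow_eq (x : ℝ≥0∞) {n : ℕ} (hn : n ≠ 0) : ∃ y : ℝ≥0∞, x = y ^ n := by
  refine ⟨x ^ (1 / n : ℝ), ?_⟩
  rw [← ENNReal.rpow_natCast, ← ENNReal.rpow_mul, one_div, inv_mul_cancel₀ (by exact_mod_cast hn),
    ENNReal.rpow_one]

namespace SmoothingLevels

variable {n : ℕ} {μ : ℕ → Measure E} {g : ℕ → E → ℝ≥0} {K : ℕ → Kernel E E} {W : ℝ≥0∞} {γ : ℝ}

theorem lintegral_mul (h : SmoothingLevels n μ g K W γ) {k : ℕ} (hk : 1 ≤ k) (hkn : k < n)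
    {f : E → ℝ≥0∞} (hf : Measurable f) :
    ∫⁻ x, g k x * f x ∂(μ k) = ∫⁻ x, f x ∂(μ (k + 1)) := by
  rw [h.density k hk hkn, lintegral_withDensity_eq_lintegral_mul _
    (h.measurable k).coe_nnreal_ennreal hf]
  rfl

/-- Passing to the previous level costs a factor `γ^{p-1}` in the `p`-th moment. -/
theorem lintegral_mul_rpow_le (h : SmoothingLevels n μ g K W γ) {k : ℕ} (hk : 1 ≤ k)
    (hkn : k < n) {f : E → ℝ≥0∞} (hf : Measurable f) {p : ℝ} (hp : 1 ≤ p) :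
    ∫⁻ x, (g k x * f x) ^ p ∂(μ k)
      ≤ ENNReal.ofReal γ ^ (p - 1) * ∫⁻ x, f x ^ p ∂(μ (k + 1)) := by
  rw [← h.lintegral_mul hk hkn (hf.pow_const p), ← lintegral_const_mul _
    (by have := (h.measurable k).coe_nnreal_ennreal; fun_prop)]
  refine lintegral_mono_ae ?_
  filter_upwards [h.density_le k hk hkn] with x hx
  have h1 : (g k x : ℝ≥0∞) ≤ ENNReal.ofReal γ := by
    rw [← ENNReal.ofReal_coe_nnreal]; exact ENNReal.ofReal_le_ofReal hx
  rw [ENNReal.mul_rpow_of_nonneg _ _ (by linarith), ← mul_assoc]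
  gcongr
  calc (g k x : ℝ≥0∞) ^ p = (g k x : ℝ≥0∞) ^ (p - 1) * g k x := by
        conv_lhs => rw [show p = (p - 1) + 1 by ring,
          ENNReal.rpow_add_of_nonneg _ _ (by linarith) zero_le_one, ENNReal.rpow_one]
    _ ≤ _ := by gcongr

theorem lintegral_feynmanKac (h : SmoothingLevels n μ g K W γ) {f : E → ℝ≥0∞} (hf : Measurable f)
    {j d : ℕ} (hj : 1 ≤ j) (hjd : j + d ≤ n) :
    ∫⁻ x, feynmanKac g K j d f x ∂(μ j) = ∫⁻ x, f x ∂(μ (j + d)) := by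
  induction d generalizing j with
  | zero => rfl
  | succ d ih =>
    have hm := measurable_feynmanKac h.measurable K hf (j + 1) d
    simp only [feynmanKac]
    rw [h.lintegral_mul hj (by omega) (measurable_lact _ hm),
      (h.smoothing j hj (by omega)).lintegral_lact _ hm, ih (by omega) (by omega)]
    congr 2; ring

theorem lintegral_feynmanKac_one (h : SmoothingLevels n μ g K W γ) {j d : ℕ} (hj : 1 ≤ j)
    (hjd : j + d ≤ n) : ∫⁻ x, feynmanKac g K j d (fun _ => 1) x ∂(μ j) = 1 := by
  have := h.isProb (j + d) (by omega) hjd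
  rw [h.lintegral_feynmanKac measurable_const hj hjd]
  simp

theorem one_le_ofReal (h : SmoothingLevels n μ g K W γ) : 1 ≤ ENNReal.ofReal γ := by
  simpa using h.one_le_bound

/-- The second moment of `Q_{j,k} 1` is bounded uniformly in the number of steps: `2 γ W` is
carried to the previous level, since `(2γ)^{1/(1+γ)} ≤ 2`. -/
theorem lintegral_feynmanKac_one_sq_le (h : SmoothingLevels n μ g K W γ) {j d : ℕ} (hj : 1 ≤ j)
    (hjd : j + d ≤ n) : ∫⁻ x, feynmanKac g K j d (fun _ => 1) x ^ (2 : ℝ) ∂(μ j)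
      ≤ 2 * ENNReal.ofReal γ * W := by
  have hγ := h.one_le_bound
  induction d generalizing j with
  | zero =>
    have := h.isProb j hj (by omega)
    simp only [feynmanKac, ENNReal.one_rpow, lintegral_const, measure_univ, mul_one]
    calc (1 : ℝ≥0∞) = 1 * 1 * 1 := by simp
      _ ≤ 2 * ENNReal.ofReal γ * W :=
        mul_le_mul' (mul_le_mul' (by norm_num) h.one_le_ofReal) h.one_le_mass
  | succ d ih =>
    have hm := measurable_feynmanKac h.measurable K (measurable_const (a := (1 : ℝ≥0∞))) (j + 1) d
    have hs := h.smoothing j hj (by omega)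
    refine (h.lintegral_mul_rpow_le hj (by omega) (measurable_lact _ hm) (by norm_num)).trans ?_
    have h1 := hs.sq_le_of_mean_one _ hm (h.lintegral_feynmanKac_one (by omega) (by omega))
    have hθ : 0 ≤ 1 / (1 + γ) := by positivity
    have hθ1 : 0 ≤ 1 - 1 / (1 + γ) := by
      rw [sub_nonneg, div_le_one (by linarith)]; linarith
    have h2 := ENNReal.rpow_le_rpow (ih (j := j + 1) (by omega) (by omega)) hθ
    have h3 : (2 * ENNReal.ofReal γ) ^ (1 / (1 + γ)) ≤ 2 := by
      have h4 : γ ≤ 2 ^ γ := by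
        have := one_add_mul_self_le_rpow_one_add (s := 1) (by norm_num) hγ
        rw [one_add_one_eq_two] at this
        linarith
      have h5 : 2 * ENNReal.ofReal γ ≤ (2 : ℝ≥0∞) ^ (1 + γ) := by
        rw [ENNReal.rpow_add_of_nonneg _ _ zero_le_one (by linarith), ENNReal.rpow_one]
        refine mul_le_mul_right ((ENNReal.ofReal_le_ofReal h4).trans (le_of_eq ?_)) _
        rw [← ENNReal.ofReal_rpow_of_pos two_pos]
        simp
      refine (ENNReal.rpow_le_rpow h5 hθ).trans (le_of_eq ?_)
      rw [← ENNReal.rpow_mul, mul_one_div, div_self (by linarith), ENNReal.rpow_one]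
    rw [show (2 - 1 : ℝ) = 1 by norm_num, ENNReal.rpow_one]
    calc ENNReal.ofReal γ * ∫⁻ x, lact (K (j + 1))
            (feynmanKac g K (j + 1) d fun _ => 1) x ^ (2 : ℝ) ∂(μ (j + 1))
        ≤ ENNReal.ofReal γ * (W ^ (1 - 1 / (1 + γ)) *
            (2 * ENNReal.ofReal γ * W) ^ (1 / (1 + γ))) := by
          refine mul_le_mul_right (h1.trans ?_) _
          exact mul_le_mul_right h2 _
      _ = (2 * ENNReal.ofReal γ) ^ (1 / (1 + γ)) * ENNReal.ofReal γ *
            (W ^ (1 - 1 / (1 + γ)) * W ^ (1 / (1 + γ))) := by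
          rw [ENNReal.mul_rpow_of_nonneg _ _ hθ]; ring
      _ = (2 * ENNReal.ofReal γ) ^ (1 / (1 + γ)) * ENNReal.ofReal γ * W := by
          rw [← ENNReal.rpow_add_of_nonneg _ _ hθ1 hθ, sub_add_cancel, ENNReal.rpow_one]
      _ ≤ 2 * ENNReal.ofReal γ * W := by gcongr

theorem lintegral_feynmanKac_one_cube_le (h : SmoothingLevels n μ g K W γ) {j d : ℕ}
    (hj : 1 ≤ j) (hjd : j + d ≤ n) :
    ∫⁻ x, feynmanKac g K j d (fun _ => 1) x ^ (3 : ℝ) ∂(μ j)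
      ≤ ENNReal.ofReal γ ^ (2 : ℝ) * (W ^ (1 / 2 : ℝ) *
        (2 * ENNReal.ofReal γ * W) ^ (3 / 2 : ℝ)) := by
  have h1γ := h.one_le_ofReal
  have h1W := h.one_le_mass
  cases d with
  | zero =>
    have := h.isProb j hj (by omega)
    simp only [feynmanKac, ENNReal.one_rpow, lintegral_const, measure_univ, mul_one]
    have h2 : (1 : ℝ≥0∞) ≤ 2 * ENNReal.ofReal γ * W := by
      calc (1 : ℝ≥0∞) = 1 * 1 * 1 := by simp
        _ ≤ 2 * ENNReal.ofReal γ * W := mul_le_mul' (mul_le_mul' (by norm_num) h1γ) h1W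
    calc (1 : ℝ≥0∞) = 1 * (1 * 1) := by simp
      _ ≤ _ := mul_le_mul' (ENNReal.one_le_rpow h1γ (by norm_num))
        (mul_le_mul' (ENNReal.one_le_rpow h1W (by norm_num))
          (ENNReal.one_le_rpow h2 (by norm_num)))
  | succ d =>
    have hm := measurable_feynmanKac h.measurable K (measurable_const (a := (1 : ℝ≥0∞))) (j + 1) d
    have hs := h.smoothing j hj (by omega)
    refine (h.lintegral_mul_rpow_le hj (by omega) (measurable_lact _ hm) (by norm_num)).trans ?_
    rw [show (3 - 1 : ℝ) = 2 by norm_num]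
    refine mul_le_mul_right ((hs.cube_le_sq _ hm).trans (mul_le_mul_right ?_ _)) _
    exact ENNReal.rpow_le_rpow
      (h.lintegral_feynmanKac_one_sq_le (by omega) (by omega)) (by norm_num)

/-- `Q_{j,k}` is bounded on `L^{3/2}`, uniformly in the number of steps: the mean of `F` is
preserved, and the bound for the `L²` norm after a mutation step involves the `L^{3/2}` norm with an
exponent less than one. -/
theorem lintegral_feynmanKac_rpow_le (h : SmoothingLevels n μ g K W γ) {f : E → ℝ≥0∞}
    (hf : Measurable f) {j d : ℕ} (hj : 1 ≤ j) (hjd : j + d ≤ n) :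
    ∫⁻ x, feynmanKac g K j d f x ^ (3 / 2 : ℝ) ∂(μ j)
      ≤ ENNReal.ofReal γ ^ (3 / 2 : ℝ) * W ^ (1 / 2 : ℝ) *
        ∫⁻ x, f x ^ (3 / 2 : ℝ) ∂(μ (j + d)) := by
  induction d generalizing j with
  | zero =>
    refine le_mul_of_one_le_left' ?_
    calc (1 : ℝ≥0∞) = 1 * 1 := by simp
      _ ≤ _ := mul_le_mul' (ENNReal.one_le_rpow h.one_le_ofReal (by norm_num))
          (ENNReal.one_le_rpow h.one_le_mass (by norm_num))
  | succ d ih =>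
    have hm := measurable_feynmanKac h.measurable K hf (j + 1) d
    have hs := h.smoothing j hj (by omega)
    have hml := measurable_lact (K (j + 1)) hm
    refine (h.lintegral_mul_rpow_le hj (by omega) hml (by norm_num)).trans ?_
    have hidx : j + 1 + d = j + (d + 1) := by ring
    have ih' := ih (j := j + 1) (by omega) (by omega)
    have h1 := lintegral_rpow_le_interpolation (π := μ (j + 1)) hml (p := 3 / 2)
      (by norm_num) (by norm_num)
    rw [hs.lintegral_lact _ hm, h.lintegral_feynmanKac hf (by omega) (by omega)] at h1
    have h2 := hs.sq_le _ hm
    rw [hidx] at h1 ih'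
    set Y := ∫⁻ x, f x ^ (3 / 2 : ℝ) ∂(μ (j + (d + 1))) with hY
    have := h.isProb (j + (d + 1)) (by omega) hjd
    have hmean : ∫⁻ x, f x ∂(μ (j + (d + 1))) ≤ Y ^ (2 / 3 : ℝ) := lintegral_le_norm32 hf
    rw [show (3 / 2 - 1 : ℝ) = 1 / 2 by norm_num]
    rw [show (2 - 3 / 2 : ℝ) = 1 / 2 by norm_num, show (3 / 2 - 1 : ℝ) = 1 / 2 by norm_num] at h1
    calc ENNReal.ofReal γ ^ (1 / 2 : ℝ) * ∫⁻ x, lact (K (j + 1))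
            (feynmanKac g K (j + 1) d f) x ^ (3 / 2 : ℝ) ∂(μ (j + 1))
        ≤ ENNReal.ofReal γ ^ (1 / 2 : ℝ) * ((Y ^ (2 / 3 : ℝ)) ^ (1 / 2 : ℝ) *
            (W ^ (1 / 3 : ℝ) * (ENNReal.ofReal γ ^ (3 / 2 : ℝ) * W ^ (1 / 2 : ℝ) * Y) ^
              (4 / 3 : ℝ)) ^ (1 / 2 : ℝ)) := by
          refine mul_le_mul_right (h1.trans (mul_le_mul' (ENNReal.rpow_le_rpow hmean (by norm_num))
            (ENNReal.rpow_le_rpow (h2.trans ?_) (by norm_num)))) _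
          exact mul_le_mul_right (ENNReal.rpow_le_rpow ih' (by norm_num)) _
      _ = ENNReal.ofReal γ ^ (3 / 2 : ℝ) * W ^ (1 / 2 : ℝ) * Y := by
          obtain ⟨G, hG⟩ := exists_pow_eq (ENNReal.ofReal γ) (n := 2) (by norm_num)
          obtain ⟨V, hV⟩ := exists_pow_eq W (n := 6) (by norm_num)
          obtain ⟨y, hy⟩ := exists_pow_eq Y (n := 3) (by norm_num)
          rw [hG, hV, hy, pow_rpow_eq G (m := 1) (by norm_num), pow_rpow_eq G (m := 3) (by norm_num),
            pow_rpow_eq y (m := 2) (by norm_num), pow_rpow_eq y (m := 1) (by norm_num),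
            pow_rpow_eq V (m := 2) (by norm_num), pow_rpow_eq V (m := 3) (by norm_num),
            show G ^ 3 * V ^ 3 * y ^ 3 = (G * V * y) ^ 3 by ring, pow_rpow_eq _ (m := 4) (by norm_num),
            show V ^ 2 * (G * V * y) ^ 4 = (V * (G * V * y) ^ 2) ^ 2 by ring,
            pow_rpow_eq _ (m := 1) (by norm_num)]
          ring

theorem lintegral_feynmanKac_cube_le (h : SmoothingLevels n μ g K W γ) {f : E → ℝ≥0∞}
    (hf : Measurable f) {j d : ℕ} (hj : 1 ≤ j) (hd : 1 ≤ d) (hjd : j + d ≤ n) :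
    ∫⁻ x, feynmanKac g K j d f x ^ (3 : ℝ) ∂(μ j)
      ≤ ENNReal.ofReal γ ^ (2 : ℝ) * (W * (ENNReal.ofReal γ ^ (3 / 2 : ℝ) * W ^ (1 / 2 : ℝ) *
        ∫⁻ x, f x ^ (3 / 2 : ℝ) ∂(μ (j + d))) ^ (2 : ℝ)) := by
  obtain ⟨d, rfl⟩ : ∃ d', d = d' + 1 := ⟨d - 1, by omega⟩
  have hm := measurable_feynmanKac h.measurable K hf (j + 1) d
  have hs := h.smoothing j hj (by omega)
  refine (h.lintegral_mul_rpow_le hj (by omega) (measurable_lact _ hm) (by norm_num)).trans ?_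
  rw [show (3 - 1 : ℝ) = 2 by norm_num]
  refine mul_le_mul_right ((hs.cube_le _ hm).trans (mul_le_mul_right ?_ _)) _
  have h1 := h.lintegral_feynmanKac_rpow_le hf (j := j + 1) (d := d) (by omega) (by omega)
  rw [show j + 1 + d = j + (d + 1) by ring] at h1
  exact ENNReal.rpow_le_rpow h1 (by norm_num)

/-- Coalescence of two lineages, a product of two functions transported over the same levels, is a
bounded operation on `L^{3/2}`, with a constant that does not depend on the number of steps. -/
theorem norm32_feynmanKac_mul_le (h : SmoothingLevels n μ g K W γ) {f : E → ℝ≥0∞}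
    (hf : Measurable f) {j d : ℕ} (hj : 1 ≤ j) (hd : 1 ≤ d) (hjd : j + d ≤ n) :
    norm32 (μ j) (fun x => feynmanKac g K j d (fun _ => 1) x * feynmanKac g K j d f x)
      ≤ 2 ^ (1 / 2 : ℝ) * ENNReal.ofReal γ ^ (17 / 6 : ℝ) * W ^ (4 / 3 : ℝ) *
        norm32 (μ (j + d)) f := by
  have hm1 := measurable_feynmanKac h.measurable K (measurable_const (a := (1 : ℝ≥0∞))) j d
  have hmf := measurable_feynmanKac h.measurable K hf j d
  have h1 := ENNReal.lintegral_mul_norm_pow_le (μ := μ j) (hm1.pow_const (3 : ℝ)).aemeasurable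
    (hmf.pow_const (3 : ℝ)).aemeasurable (p := 1 / 2) (q := 1 / 2) (by norm_num) (by norm_num)
    (by norm_num)
  have h2 : ∀ x, (feynmanKac g K j d (fun _ => 1) x * feynmanKac g K j d f x) ^ (3 / 2 : ℝ)
      = (feynmanKac g K j d (fun _ => 1) x ^ (3 : ℝ)) ^ (1 / 2 : ℝ) *
        (feynmanKac g K j d f x ^ (3 : ℝ)) ^ (1 / 2 : ℝ) := fun x => by
    rw [ENNReal.mul_rpow_of_nonneg _ _ (by norm_num), ← ENNReal.rpow_mul, ← ENNReal.rpow_mul]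
    norm_num
  have h3 := h.lintegral_feynmanKac_one_cube_le hj hjd
  have h4 := h.lintegral_feynmanKac_cube_le hf hj hd hjd
  unfold norm32
  simp only [h2]
  refine (ENNReal.rpow_le_rpow (h1.trans (mul_le_mul' (ENNReal.rpow_le_rpow h3 (by norm_num))
    (ENNReal.rpow_le_rpow h4 (by norm_num)))) (by norm_num)).trans (le_of_eq ?_)
  obtain ⟨G, hG⟩ := exists_pow_eq (ENNReal.ofReal γ) (n := 6) (by norm_num)
  obtain ⟨V, hV⟩ := exists_pow_eq W (n := 6) (by norm_num)
  obtain ⟨s, hs⟩ := exists_pow_eq 2 (n := 2) (by norm_num)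
  obtain ⟨y, hy⟩ := exists_pow_eq (∫⁻ x, f x ^ (3 / 2 : ℝ) ∂(μ (j + d))) (n := 3) (by norm_num)
  rw [hG, hV, hy, hs, ← ENNReal.mul_rpow_of_nonneg _ _ (by norm_num), ← ENNReal.rpow_mul,
    show (1 / 2 * (2 / 3) : ℝ) = 1 / 3 by norm_num,
    show s ^ 2 * G ^ 6 * V ^ 6 = (s * G ^ 3 * V ^ 3) ^ 2 by ring,
    pow_rpow_eq (s * G ^ 3 * V ^ 3) (m := 3) (by norm_num),
    pow_rpow_eq G (m := 12) (by norm_num), pow_rpow_eq G (m := 9) (by norm_num),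
    pow_rpow_eq G (m := 17) (by norm_num), pow_rpow_eq V (m := 3) (by norm_num),
    pow_rpow_eq V (m := 8) (by norm_num), pow_rpow_eq s (m := 1) (by norm_num),
    pow_rpow_eq y (m := 2) (by norm_num), ENNReal.rpow_two,
    show G ^ 12 * (V ^ 3 * (s * G ^ 3 * V ^ 3) ^ 3) * (G ^ 12 * (V ^ 6 * (G ^ 9 * V ^ 3 * y ^ 3) ^ 2))
      = (s * G ^ 17 * V ^ 8 * y ^ 2) ^ 3 by ring,
    pow_rpow_eq _ (m := 1) (by norm_num)]
  ring

theorem norm32_feynmanKac_one_sq_le (h : SmoothingLevels n μ g K W γ) {j d : ℕ} (hj : 1 ≤ j)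
    (hjd : j + d ≤ n) :
    norm32 (μ j) (fun x => feynmanKac g K j d (fun _ => 1) x * feynmanKac g K j d (fun _ => 1) x)
      ≤ 2 * ENNReal.ofReal γ ^ (7 / 3 : ℝ) * W ^ (4 / 3 : ℝ) := by
  have h2 : ∀ x, (feynmanKac g K j d (fun _ => 1) x *
      feynmanKac g K j d (fun _ => 1) x) ^ (3 / 2 : ℝ)
      = feynmanKac g K j d (fun _ => 1) x ^ (3 : ℝ) := fun x => by
    rw [← sq, ← ENNReal.rpow_two, ← ENNReal.rpow_mul]; norm_num
  have h3 := h.lintegral_feynmanKac_one_cube_le hj hjd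
  unfold norm32
  simp only [h2]
  refine (ENNReal.rpow_le_rpow h3 (by norm_num)).trans (le_of_eq ?_)
  obtain ⟨G, hG⟩ := exists_pow_eq (ENNReal.ofReal γ) (n := 6) (by norm_num)
  obtain ⟨V, hV⟩ := exists_pow_eq W (n := 6) (by norm_num)
  obtain ⟨s, hs⟩ := exists_pow_eq 2 (n := 2) (by norm_num)
  rw [hG, hV, hs, show s ^ 2 * G ^ 6 * V ^ 6 = (s * G ^ 3 * V ^ 3) ^ 2 by ring,
    pow_rpow_eq (s * G ^ 3 * V ^ 3) (m := 3) (by norm_num),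
    pow_rpow_eq G (m := 12) (by norm_num), pow_rpow_eq V (m := 3) (by norm_num),
    pow_rpow_eq G (m := 14) (by norm_num), pow_rpow_eq V (m := 8) (by norm_num),
    show G ^ 12 * (V ^ 3 * (s * G ^ 3 * V ^ 3) ^ 3) = (s * G ^ 7 * V ^ 4) ^ 3 by ring,
    pow_rpow_eq _ (m := 2) (by norm_num)]
  ring

end SmoothingLevels

/-! ### Resampling and mutation -/

/-- The empirical mean of `f` over the particles. -/
def empMean {N : ℕ} (f : E → ℝ≥0∞) (ξ : Fin N → E) : ℝ≥0∞ := (∑ i, f (ξ i)) / N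

theorem measurable_empMean {N : ℕ} {f : E → ℝ≥0∞} (hf : Measurable f) :
    Measurable (empMean (N := N) f) :=
  (Finset.measurable_sum _ fun i _ => hf.comp (measurable_pi_apply i)).div_const _

theorem lintegral_pi_eval {N : ℕ} {ρ : Measure E} [IsProbabilityMeasure ρ] {f : E → ℝ≥0∞}
    (hf : Measurable f) (i : Fin N) :
    ∫⁻ ξ, f (ξ i) ∂(Measure.pi fun _ : Fin N => ρ) = ∫⁻ x, f x ∂ρ :=
  (measurePreserving_eval (fun _ : Fin N => ρ) i).lintegral_comp hf

theorem lintegral_pi_eval_mul {N : ℕ} {ρ : Measure E} [IsProbabilityMeasure ρ] {f₁ f₂ : E → ℝ≥0∞}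
    (hf₁ : Measurable f₁) (hf₂ : Measurable f₂) {i j : Fin N} (hij : i ≠ j) :
    ∫⁻ ξ, f₁ (ξ i) * f₂ (ξ j) ∂(Measure.pi fun _ : Fin N => ρ)
      = (∫⁻ x, f₁ x ∂ρ) * ∫⁻ x, f₂ x ∂ρ := by
  have hind : IndepFun (fun ξ : Fin N → E => f₁ (ξ i)) (fun ξ => f₂ (ξ j))
      (Measure.pi fun _ : Fin N => ρ) :=
    ((iIndepFun_pi (μ := fun _ : Fin N => ρ) (X := fun _ => id)
      fun _ => aemeasurable_id).indepFun hij).comp hf₁ hf₂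
  have h₁ : Measurable fun ξ : Fin N → E => f₁ (ξ i) := hf₁.comp (measurable_pi_apply i)
  have h₂ : Measurable fun ξ : Fin N → E => f₂ (ξ j) := hf₂.comp (measurable_pi_apply j)
  rw [lintegral_mul_eq_lintegral_mul_lintegral_of_indepFun'' h₁.aemeasurable h₂.aemeasurable hind,
    lintegral_pi_eval hf₁, lintegral_pi_eval hf₂]

/-- The second moment of empirical means of independent particles. -/
theorem lintegral_pi_empMean_mul_le {N : ℕ} [NeZero N] {ρ : Measure E} [IsProbabilityMeasure ρ]
    {f₁ f₂ : E → ℝ≥0∞} (hf₁ : Measurable f₁) (hf₂ : Measurable f₂) :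
    ∫⁻ ξ, empMean f₁ ξ * empMean f₂ ξ ∂(Measure.pi fun _ : Fin N => ρ)
      ≤ (∫⁻ x, f₁ x ∂ρ) * (∫⁻ x, f₂ x ∂ρ) + (∫⁻ x, f₁ x * f₂ x ∂ρ) / N := by
  have hN0 : (N : ℝ≥0∞) ≠ 0 := by exact_mod_cast NeZero.ne N
  have hNt : (N : ℝ≥0∞) ≠ ∞ := ENNReal.natCast_ne_top N
  have hm : ∀ i j : Fin N, Measurable fun ξ : Fin N → E => f₁ (ξ i) * f₂ (ξ j) := fun i j =>
    (hf₁.comp (measurable_pi_apply i)).mul (hf₂.comp (measurable_pi_apply j))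
  have h1 : ∀ ξ : Fin N → E, empMean f₁ ξ * empMean f₂ ξ
      = ((N : ℝ≥0∞)⁻¹ * (N : ℝ≥0∞)⁻¹) * ∑ i, ∑ j, f₁ (ξ i) * f₂ (ξ j) := fun ξ => by
    rw [empMean, empMean, ← Finset.sum_mul_sum, div_eq_mul_inv, div_eq_mul_inv]; ring
  simp only [h1]
  rw [lintegral_const_mul _ (Finset.measurable_sum _ fun i _ => Finset.measurable_sum _
    fun j _ => hm i j), lintegral_finsetSum _ fun i _ => Finset.measurable_sum _ fun j _ => hm i j]
  have h2 : ∀ i j : Fin N, ∫⁻ ξ, f₁ (ξ i) * f₂ (ξ j) ∂(Measure.pi fun _ : Fin N => ρ)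
      ≤ (∫⁻ x, f₁ x ∂ρ) * (∫⁻ x, f₂ x ∂ρ) + if i = j then ∫⁻ x, f₁ x * f₂ x ∂ρ else 0 := by
    intro i j
    rcases eq_or_ne i j with rfl | hij
    · rw [if_pos rfl, lintegral_pi_eval (f := fun x => f₁ x * f₂ x) (hf₁.mul hf₂)]
      exact le_add_self
    · rw [if_neg hij, add_zero, lintegral_pi_eval_mul hf₁ hf₂ hij]
  set A := (∫⁻ x, f₁ x ∂ρ) * (∫⁻ x, f₂ x ∂ρ)
  set B := ∫⁻ x, f₁ x * f₂ x ∂ρ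
  calc (N : ℝ≥0∞)⁻¹ * (N : ℝ≥0∞)⁻¹ * ∑ i, ∫⁻ ξ, ∑ j, f₁ (ξ i) * f₂ (ξ j) ∂(Measure.pi
        fun _ : Fin N => ρ)
      ≤ (N : ℝ≥0∞)⁻¹ * (N : ℝ≥0∞)⁻¹ * ∑ i : Fin N, ∑ j : Fin N, (A + if i = j then B else 0) := by
        refine mul_le_mul_right (Finset.sum_le_sum fun i _ => ?_) _
        rw [lintegral_finsetSum _ fun j _ => hm i j]
        exact Finset.sum_le_sum fun j _ => h2 i j
    _ = ((N : ℝ≥0∞) * (N : ℝ≥0∞)⁻¹) * ((N : ℝ≥0∞) * (N : ℝ≥0∞)⁻¹) * A +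
          ((N : ℝ≥0∞) * (N : ℝ≥0∞)⁻¹) * (B * (N : ℝ≥0∞)⁻¹) := by
        simp only [Finset.sum_add_distrib, Finset.sum_const, Finset.card_univ, Fintype.card_fin,
          nsmul_eq_mul, Finset.sum_ite_eq, Finset.mem_univ, if_true]
        ring
    _ = A + B / N := by
        rw [ENNReal.mul_inv_cancel hN0 hNt, one_mul, one_mul, one_mul, div_eq_mul_inv]

theorem isMarkovKernel_weightedEmpirical {N : ℕ} [NeZero N] (g : E → ℝ≥0) (hg : Measurable g) :
    IsMarkovKernel (weightedEmpirical (N := N) g hg) := by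
  refine ⟨fun ξ => ⟨?_⟩⟩
  change (∑ j, (weight g ξ j : ℝ≥0∞) • Measure.dirac (ξ j)) Set.univ = 1
  simp only [Measure.coe_finsetSum, Finset.sum_apply, Measure.smul_apply, smul_eq_mul,
    measure_univ, mul_one]
  rw [← ENNReal.ofNNReal_finsetSum, ENNReal.coe_eq_one]
  unfold weight
  split_ifs with h
  · simp
  · rw [← Finset.sum_div, div_self h]

theorem lintegral_weightedEmpirical {N : ℕ} (g : E → ℝ≥0) (hg : Measurable g) (ξ : Fin N → E)
    {f : E → ℝ≥0∞} (hf : Measurable f) :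
    ∫⁻ x, f x ∂(weightedEmpirical g hg ξ) = ∑ j, (weight g ξ j : ℝ≥0∞) * f (ξ j) := by
  change ∫⁻ x, f x ∂(∑ j, (weight g ξ j : ℝ≥0∞) • Measure.dirac (ξ j)) = _
  rw [lintegral_finsetSum_measure]
  refine Finset.sum_congr rfl fun j _ => ?_
  rw [lintegral_smul_measure, lintegral_dirac' _ hf, smul_eq_mul]

/-- The normalization of the resampling weights cancels against the mean weight; if all weights
vanish, both sides are zero. -/
theorem empMean_mul_lintegral_weightedEmpirical {N : ℕ} [NeZero N] (g : E → ℝ≥0)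
    (hg : Measurable g) (ξ : Fin N → E) {f : E → ℝ≥0∞} (hf : Measurable f) :
    empMean (fun x => (g x : ℝ≥0∞)) ξ * ∫⁻ x, f x ∂(weightedEmpirical g hg ξ)
      = empMean (fun x => g x * f x) ξ := by
  rw [lintegral_weightedEmpirical g hg ξ hf]
  by_cases h : ∑ l, g (ξ l) = 0
  · have h0 : ∀ l, g (ξ l) = 0 := fun l => Finset.sum_eq_zero_iff.1 h l (Finset.mem_univ l)
    simp [empMean, h0]
  · have hs : (∑ l, (g (ξ l) : ℝ≥0∞)) ≠ 0 := by
      rw [← ENNReal.ofNNReal_finsetSum]; exact_mod_cast h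
    have hs' : (∑ l, (g (ξ l) : ℝ≥0∞)) ≠ ∞ := by
      rw [← ENNReal.ofNNReal_finsetSum]; exact ENNReal.coe_ne_top
    have hw : ∀ j, (weight g ξ j : ℝ≥0∞) = g (ξ j) * (∑ l, (g (ξ l) : ℝ≥0∞))⁻¹ := fun j => by
      rw [weight, if_neg h, ENNReal.coe_div h, ENNReal.ofNNReal_finsetSum, div_eq_mul_inv]
    simp only [hw, empMean]
    rw [div_eq_mul_inv, div_eq_mul_inv, mul_assoc, mul_comm (N : ℝ≥0∞)⁻¹, ← mul_assoc,
      Finset.mul_sum]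
    congr 1
    refine Finset.sum_congr rfl fun j _ => ?_
    rw [mul_comm ((g (ξ j) : ℝ≥0∞)), mul_assoc, ← mul_assoc, ENNReal.mul_inv_cancel hs hs', one_mul]

/-- One step of the particle system: resampling followed by mutation. -/
def particleKernel (N : ℕ) (g : E → ℝ≥0) (hg : Measurable g) (K : Kernel E E) [IsMarkovKernel K] :
    Kernel (Fin N → E) (Fin N → E) :=
  mutate N K ∘ₖ resample N g hg

/-- Given the particles of one level, those of the next are independent and identically
distributed. -/
theorem particleKernel_apply {N : ℕ} [NeZero N] (g : E → ℝ≥0) (hg : Measurable g)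
    (K : Kernel E E) [IsMarkovKernel K] (ξ : Fin N → E) :
    particleKernel N g hg K ξ = Measure.pi fun _ => (weightedEmpirical g hg ξ).bind K := by
  have := isMarkovKernel_weightedEmpirical (N := N) g hg
  symm
  refine Measure.pi_eq fun s hs => ?_
  rw [particleKernel, Kernel.comp_apply, Measure.bind_apply (MeasurableSet.univ_pi hs)
    (Kernel.aemeasurable _)]
  have h1 : ∀ ζ : Fin N → E, mutate N K ζ (Set.pi Set.univ s) = ∏ i, K (ζ i) (s i) := fun ζ => by
    change Measure.pi (fun i => K (ζ i)) (Set.pi Set.univ s) = _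
    rw [Measure.pi_pi]
  simp only [h1]
  change ∫⁻ ζ, ∏ i, K (ζ i) (s i) ∂(Measure.pi fun _ : Fin N => weightedEmpirical g hg ξ) = _
  have hm : ∀ i, Measurable fun x => K x (s i) := fun i => K.measurable_coe (hs i)
  have hind : iIndepFun (fun (i : Fin N) (ζ : Fin N → E) => K (ζ i) (s i))
      (Measure.pi fun _ : Fin N => weightedEmpirical g hg ξ) :=
    iIndepFun_pi (μ := fun _ : Fin N => weightedEmpirical g hg ξ)
      (X := fun i x => K x (s i)) fun i => (hm i).aemeasurable
  rw [lintegral_prod_eq_prod_lintegral_of_indepFun Finset.univ _ hind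
    fun i => (hm i).comp (measurable_pi_apply i)]
  refine Finset.prod_congr rfl fun i _ => ?_
  rw [lintegral_pi_eval (hm i), Measure.bind_apply (hs i) (Kernel.aemeasurable _)]

theorem isMarkovKernel_particleKernel {N : ℕ} [NeZero N] (g : E → ℝ≥0) (hg : Measurable g)
    (K : Kernel E E) [IsMarkovKernel K] : IsMarkovKernel (particleKernel N g hg K) := by
  have := isMarkovKernel_weightedEmpirical (N := N) g hg
  exact ⟨fun ξ => by rw [particleKernel_apply]; infer_instance⟩

theorem lintegral_particleKernel_eval {N : ℕ} [NeZero N] (g : E → ℝ≥0) (hg : Measurable g)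
    (K : Kernel E E) [IsMarkovKernel K] (ξ : Fin N → E) {f : E → ℝ≥0∞} (hf : Measurable f)
    (i : Fin N) :
    empMean (fun x => (g x : ℝ≥0∞)) ξ * ∫⁻ ζ, f (ζ i) ∂(particleKernel N g hg K ξ)
      = empMean (fun x => g x * lact K f x) ξ := by
  have := isMarkovKernel_weightedEmpirical (N := N) g hg
  rw [particleKernel_apply, lintegral_pi_eval hf,
    Measure.lintegral_bind (Kernel.aemeasurable _) hf.aemeasurable]
  exact empMean_mul_lintegral_weightedEmpirical g hg ξ (measurable_lact K hf)

theorem lintegral_particleKernel_mul_le {N : ℕ} [NeZero N] (g : E → ℝ≥0) (hg : Measurable g)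
    (K : Kernel E E) [IsMarkovKernel K] (ξ : Fin N → E) {f₁ f₂ : E → ℝ≥0∞} (hf₁ : Measurable f₁)
    (hf₂ : Measurable f₂) :
    empMean (fun x => (g x : ℝ≥0∞)) ξ ^ 2 *
        ∫⁻ ζ, empMean f₁ ζ * empMean f₂ ζ ∂(particleKernel N g hg K ξ)
      ≤ empMean (fun x => g x * lact K f₁ x) ξ * empMean (fun x => g x * lact K f₂ x) ξ
        + (empMean (fun x => (g x : ℝ≥0∞)) ξ *
            empMean (fun x => g x * lact K (fun y => f₁ y * f₂ y) x) ξ) / N := by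
  have := isMarkovKernel_weightedEmpirical (N := N) g hg
  have h1 := lintegral_pi_empMean_mul_le (N := N) (ρ := (weightedEmpirical g hg ξ).bind K) hf₁ hf₂
  have hf₁₂ : Measurable fun y => f₁ y * f₂ y := hf₁.mul hf₂
  have hb : ∀ {f : E → ℝ≥0∞}, Measurable f → ∫⁻ x, f x ∂((weightedEmpirical g hg ξ).bind K)
      = ∫⁻ x, lact K f x ∂(weightedEmpirical g hg ξ) := fun hf =>
    Measure.lintegral_bind (Kernel.aemeasurable _) hf.aemeasurable
  rw [hb hf₁, hb hf₂, hb hf₁₂] at h1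
  rw [particleKernel_apply]
  refine (mul_le_mul_right h1 _).trans (le_of_eq ?_)
  rw [← empMean_mul_lintegral_weightedEmpirical g hg ξ (measurable_lact K hf₁),
    ← empMean_mul_lintegral_weightedEmpirical g hg ξ (measurable_lact K hf₂),
    ← empMean_mul_lintegral_weightedEmpirical g hg ξ (measurable_lact K hf₁₂),
    div_eq_mul_inv, div_eq_mul_inv]
  ring

/-! ### The weighted particle system -/

/-- The joint law at level `k` of the normalizing constant `∏_{j < k} (1/N) ∑ i, g_j(ξ_j^i)` and
the particles. As for `particleLaw`, levels start at `1`. -/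
def weightedLaw (N : ℕ) (μ : ℕ → Measure E) (K : ℕ → Kernel E E) [∀ k, IsMarkovKernel (K k)]
    (g : ℕ → E → ℝ≥0) (hg : ∀ k, Measurable (g k)) : ℕ → Measure (ℝ≥0∞ × (Fin N → E))
  | 0 => 0
  | 1 => (Measure.pi fun _ => μ 1).map fun ξ => (1, ξ)
  | k + 2 => (weightedLaw N μ K g hg (k + 1)).bind
      (Kernel.deterministic (fun p => p.1 * empMean (fun x => (g (k + 1) x : ℝ≥0∞)) p.2)
        (measurable_fst.mul ((measurable_empMean (hg (k + 1)).coe_nnreal_ennreal).comp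
          measurable_snd)) ×ₖ
        (particleKernel N (g (k + 1)) (hg (k + 1)) (K (k + 2))).comap Prod.snd measurable_snd)

section WeightedLaw

variable {N : ℕ} {μ : ℕ → Measure E} {K : ℕ → Kernel E E} [∀ k, IsMarkovKernel (K k)]
  {g : ℕ → E → ℝ≥0} {hg : ∀ k, Measurable (g k)}

theorem lintegral_weightedLaw_one {F : ℝ≥0∞ × (Fin N → E) → ℝ≥0∞} (hF : Measurable F) :
    ∫⁻ p, F p ∂(weightedLaw N μ K g hg 1) = ∫⁻ ξ, F (1, ξ) ∂(Measure.pi fun _ => μ 1) :=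
  lintegral_map hF measurable_prodMk_left

theorem lintegral_weightedLaw_succ [NeZero N] {F : ℝ≥0∞ × (Fin N → E) → ℝ≥0∞} (hF : Measurable F) (k : ℕ) :
    ∫⁻ p, F p ∂(weightedLaw N μ K g hg (k + 2))
      = ∫⁻ p, ∫⁻ ζ, F (p.1 * empMean (fun x => (g (k + 1) x : ℝ≥0∞)) p.2, ζ)
          ∂(particleKernel N (g (k + 1)) (hg (k + 1)) (K (k + 2)) p.2)
        ∂(weightedLaw N μ K g hg (k + 1)) := by
  have := isMarkovKernel_particleKernel (N := N) (g (k + 1)) (hg (k + 1)) (K (k + 2))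
  conv_lhs => rw [weightedLaw]
  rw [Measure.lintegral_bind (Kernel.aemeasurable _) hF.aemeasurable]
  refine lintegral_congr fun p => ?_
  rw [Kernel.lintegral_deterministic_prod _ _ _ hF]
  rfl

/-- The unnormalized particle measures are unbiased, already for each single particle. -/
theorem lintegral_weightedLaw_eval [NeZero N] [IsProbabilityMeasure (μ 1)] {k : ℕ}
    (hstep : ∀ j, 1 ≤ j → j < k → ∀ f : E → ℝ≥0∞, Measurable f →
      ∫⁻ x, g j x * lact (K (j + 1)) f x ∂(μ j) = ∫⁻ x, f x ∂(μ (j + 1)))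
    (hk : 1 ≤ k) {f : E → ℝ≥0∞} (hf : Measurable f) (i : Fin N) :
    ∫⁻ p, p.1 * f (p.2 i) ∂(weightedLaw N μ K g hg k) = ∫⁻ x, f x ∂(μ k) := by
  have hm : ∀ (i : Fin N) {f : E → ℝ≥0∞}, Measurable f →
      Measurable fun p : ℝ≥0∞ × (Fin N → E) => p.1 * f (p.2 i) := fun i f hf =>
    measurable_fst.mul (hf.comp ((measurable_pi_apply i).comp measurable_snd))
  induction k, hk using Nat.le_induction generalizing f i with
  | base =>
    rw [lintegral_weightedLaw_one (hm i hf)]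
    simp only [one_mul]
    exact lintegral_pi_eval hf i
  | succ k hk ih =>
    obtain ⟨k, rfl⟩ : ∃ k', k = k' + 1 := ⟨k - 1, by omega⟩
    have hq : Measurable fun x => (g (k + 1) x : ℝ≥0∞) * lact (K (k + 1 + 1)) f x :=
      (hg (k + 1)).coe_nnreal_ennreal.mul (measurable_lact _ hf)
    rw [lintegral_weightedLaw_succ (hm i hf), ← hstep (k + 1) hk (by omega) f hf]
    have h1 : ∀ p : ℝ≥0∞ × (Fin N → E),
        ∫⁻ ζ, p.1 * empMean (fun x => (g (k + 1) x : ℝ≥0∞)) p.2 * f (ζ i)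
          ∂(particleKernel N (g (k + 1)) (hg (k + 1)) (K (k + 2)) p.2)
        = (∑ l, p.1 * (g (k + 1) (p.2 l) * lact (K (k + 2)) f (p.2 l))) / N := fun p => by
      have hfi : Measurable fun ζ : Fin N → E => f (ζ i) := hf.comp (measurable_pi_apply i)
      rw [lintegral_const_mul _ hfi, mul_assoc,
        lintegral_particleKernel_eval _ _ _ _ hf, empMean, ← Finset.mul_sum, mul_div_assoc]
    simp only [h1, div_eq_mul_inv]
    rw [lintegral_mul_const _ (Finset.measurable_sum _ fun l _ => hm l hq),
      lintegral_finsetSum _ fun l _ => hm l hq]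
    rw [Finset.sum_congr rfl fun l _ => ih (fun j h1 h2 => hstep j h1 (by omega)) hq l]
    simp only [Finset.sum_const, Finset.card_univ, Fintype.card_fin, nsmul_eq_mul]
    rw [mul_comm, ← mul_assoc, ENNReal.inv_mul_cancel (by exact_mod_cast NeZero.ne N)
      (ENNReal.natCast_ne_top N), one_mul]

/-- The second moment `E[φ_k² · η_k(f₁) · η_k(f₂)]` of the unnormalized particle measures, with
`φ_k` the normalizing constant and `η_k` the empirical measure. -/
def secondMoment (N : ℕ) (μ : ℕ → Measure E) (K : ℕ → Kernel E E) [∀ k, IsMarkovKernel (K k)]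
    (g : ℕ → E → ℝ≥0) (hg : ∀ k, Measurable (g k)) (k : ℕ) (f₁ f₂ : E → ℝ≥0∞) : ℝ≥0∞ :=
  ∫⁻ p, p.1 ^ 2 * (empMean f₁ p.2 * empMean f₂ p.2) ∂(weightedLaw N μ K g hg k)

/-- The weight with which a coalescence of two lineages at level `k` enters, tested against `F`:
`E[φ_{k-1}² · η_{k-1}(g_{k-1}) · η_{k-1}(g_{k-1} · K_k F)]`, and `μ_1(F)` at the first level. -/
def coalescence (N : ℕ) (μ : ℕ → Measure E) (K : ℕ → Kernel E E) [∀ k, IsMarkovKernel (K k)]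
    (g : ℕ → E → ℝ≥0) (hg : ∀ k, Measurable (g k)) : ℕ → (E → ℝ≥0∞) → ℝ≥0∞
  | 0, _ => 0
  | 1, F => ∫⁻ x, F x ∂(μ 1)
  | k + 2, F => secondMoment N μ K g hg (k + 1) (feynmanKac g K (k + 1) 1 fun _ => 1)
      (feynmanKac g K (k + 1) 1 F)

theorem measurable_secondMoment_integrand {f₁ f₂ : E → ℝ≥0∞} (hf₁ : Measurable f₁)
    (hf₂ : Measurable f₂) :
    Measurable fun p : ℝ≥0∞ × (Fin N → E) => p.1 ^ 2 * (empMean f₁ p.2 * empMean f₂ p.2) :=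
  (measurable_fst.pow_const 2).mul (((measurable_empMean hf₁).comp measurable_snd).mul
    ((measurable_empMean hf₂).comp measurable_snd))

theorem secondMoment_one_le [NeZero N] [IsProbabilityMeasure (μ 1)] {f₁ f₂ : E → ℝ≥0∞} (hf₁ : Measurable f₁)
    (hf₂ : Measurable f₂) :
    secondMoment N μ K g hg 1 f₁ f₂ ≤ (∫⁻ x, f₁ x ∂(μ 1)) * (∫⁻ x, f₂ x ∂(μ 1))
      + coalescence N μ K g hg 1 (fun x => f₁ x * f₂ x) / N := by
  rw [secondMoment, lintegral_weightedLaw_one (measurable_secondMoment_integrand hf₁ hf₂)]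
  simp only [one_pow, one_mul]
  exact lintegral_pi_empMean_mul_le hf₁ hf₂

/-- Two particles either descend from independent draws, or share the draw with probability
`1 / N`. -/
theorem secondMoment_succ_le [NeZero N] {k : ℕ} {f₁ f₂ : E → ℝ≥0∞} (hf₁ : Measurable f₁)
    (hf₂ : Measurable f₂) :
    secondMoment N μ K g hg (k + 2) f₁ f₂
      ≤ secondMoment N μ K g hg (k + 1) (feynmanKac g K (k + 1) 1 f₁) (feynmanKac g K (k + 1) 1 f₂)
        + coalescence N μ K g hg (k + 2) (fun x => f₁ x * f₂ x) / N := by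
  have hone : (feynmanKac g K (k + 1) 1 fun _ => 1) = fun x => (g (k + 1) x : ℝ≥0∞) := by
    funext x
    simp [feynmanKac, lact]
  rw [secondMoment, lintegral_weightedLaw_succ (measurable_secondMoment_integrand hf₁ hf₂),
    coalescence, hone, secondMoment, secondMoment, div_eq_mul_inv]
  have hf₁₂ : Measurable fun y => f₁ y * f₂ y := hf₁.mul hf₂
  have hmf : ∀ {f : E → ℝ≥0∞}, Measurable f → Measurable (feynmanKac g K (k + 1) 1 f) := fun hf =>
    measurable_feynmanKac hg K hf _ _
  rw [← lintegral_mul_const _ (measurable_secondMoment_integrand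
      (hg (k + 1)).coe_nnreal_ennreal (hmf hf₁₂)),
    ← lintegral_add_left (measurable_secondMoment_integrand (hmf hf₁) (hmf hf₂))]
  refine lintegral_mono fun p => ?_
  have h1 := lintegral_particleKernel_mul_le (N := N) (g (k + 1)) (hg (k + 1)) (K (k + 2)) p.2
    hf₁ hf₂
  have h2 := mul_le_mul_right h1 (p.1 ^ 2)
  dsimp only
  have hmm : Measurable fun ζ : Fin N → E => empMean f₁ ζ * empMean f₂ ζ :=
    (measurable_empMean hf₁).mul (measurable_empMean hf₂)
  rw [lintegral_const_mul _ hmm, mul_pow, mul_assoc]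
  refine h2.trans (le_of_eq ?_)
  rw [mul_add, div_eq_mul_inv, mul_assoc (p.1 ^ 2) _ ((N : ℝ≥0∞)⁻¹)]
  rfl

/-- Unrolling the recursion: the excess of a second moment over its value for independent lineages
is the sum of the contributions of the last coalescence. -/
theorem secondMoment_le [NeZero N] [IsProbabilityMeasure (μ 1)] {e : ℕ} {f₁ f₂ : E → ℝ≥0∞}
    (hf₁ : Measurable f₁) (hf₂ : Measurable f₂)
    (hmean : ∀ f : E → ℝ≥0∞, Measurable f →
      ∫⁻ x, feynmanKac g K 1 (e - 1) f x ∂(μ 1) = ∫⁻ x, f x ∂(μ e)) {k : ℕ} (hk : 1 ≤ k)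
    (hke : k ≤ e) :
    secondMoment N μ K g hg k (feynmanKac g K k (e - k) f₁) (feynmanKac g K k (e - k) f₂)
      ≤ (∫⁻ x, f₁ x ∂(μ e)) * (∫⁻ x, f₂ x ∂(μ e))
        + (∑ j ∈ Finset.range k, coalescence N μ K g hg (j + 1) (fun x =>
            feynmanKac g K (j + 1) (e - (j + 1)) f₁ x *
              feynmanKac g K (j + 1) (e - (j + 1)) f₂ x)) / N := by
  induction k, hk using Nat.le_induction with
  | base =>
    refine (secondMoment_one_le (measurable_feynmanKac hg K hf₁ _ _)
      (measurable_feynmanKac hg K hf₂ _ _)).trans ?_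
    rw [hmean f₁ hf₁, hmean f₂ hf₂]
    simp
  | succ k hk ih =>
    obtain ⟨k, rfl⟩ : ∃ k', k = k' + 1 := ⟨k - 1, by omega⟩
    refine (secondMoment_succ_le (measurable_feynmanKac hg K hf₁ _ _)
      (measurable_feynmanKac hg K hf₂ _ _)).trans ?_
    have h1 := ih (by omega)
    rw [show e - (k + 1) = (e - (k + 1 + 1)) + 1 by omega] at h1
    rw [Finset.sum_range_succ, ENNReal.add_div, ← add_assoc]
    exact add_le_add h1 le_rfl

end WeightedLaw

/-! ### The second moment of the normalizing constant -/

namespace SmoothingLevels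

variable {N n : ℕ} {μ : ℕ → Measure E} {K : ℕ → Kernel E E} [∀ k, IsMarkovKernel (K k)]
  {g : ℕ → E → ℝ≥0} {W : ℝ≥0∞} {γ : ℝ}

theorem secondMoment_le [NeZero N] (h : SmoothingLevels n μ g K W γ) {e : ℕ} (he : e ≤ n)
    {f₁ f₂ : E → ℝ≥0∞} (hf₁ : Measurable f₁) (hf₂ : Measurable f₂) {k : ℕ} (hk : 1 ≤ k)
    (hke : k ≤ e) :
    secondMoment N μ K g h.measurable k (feynmanKac g K k (e - k) f₁) (feynmanKac g K k (e - k) f₂)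
      ≤ (∫⁻ x, f₁ x ∂(μ e)) * (∫⁻ x, f₂ x ∂(μ e))
        + (∑ j ∈ Finset.range k, coalescence N μ K g h.measurable (j + 1) (fun x =>
            feynmanKac g K (j + 1) (e - (j + 1)) f₁ x *
              feynmanKac g K (j + 1) (e - (j + 1)) f₂ x)) / N := by
  have := h.isProb 1 le_rfl (by omega)
  refine SMC.secondMoment_le hf₁ hf₂ (fun f hf => ?_) hk hke
  have h1 := h.lintegral_feynmanKac hf (j := 1) (d := e - 1) le_rfl (by omega)
  rwa [show 1 + (e - 1) = e by omega] at h1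

/-- A coalescence contributes as if the lineages were those of exact samples, up to an error of
relative order `n / N` in `L^{3/2}`. -/
theorem coalescence_le [NeZero N] (h : SmoothingLevels n μ g K W γ) {D : ℝ≥0∞}
    (hD : ∀ (f : E → ℝ≥0∞), Measurable f → ∀ j d, 1 ≤ j → 1 ≤ d → j + d ≤ n →
      norm32 (μ j) (fun x => feynmanKac g K j d (fun _ => 1) x * feynmanKac g K j d f x)
        ≤ D * norm32 (μ (j + d)) f)
    (hN : 2 * n * D ≤ N) {k : ℕ} (hk : 1 ≤ k) (hkn : k ≤ n) {F : E → ℝ≥0∞} (hF : Measurable F) :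
    coalescence N μ K g h.measurable k F
      ≤ ∫⁻ x, F x ∂(μ k) + 2 * n * D / N * norm32 (μ k) F := by
  induction k using Nat.strong_induction_on generalizing F with
  | _ k ih =>
    have hprob := h.isProb k hk hkn
    rcases Nat.eq_or_lt_of_le hk with rfl | hk2
    · exact le_self_add
    obtain ⟨k, rfl⟩ : ∃ k', k = k' + 2 := ⟨k - 2, by omega⟩
    have h1 := h.secondMoment_le (N := N) hkn (measurable_const (a := (1 : ℝ≥0∞))) hF
      (k := k + 1) (by omega) (by omega)
    rw [show k + 2 - (k + 1) = 1 by omega] at h1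
    have hcoef : 2 * n * D / N ≤ 1 := ENNReal.div_le_of_le_mul (by rwa [one_mul])
    have hterm : ∀ j ∈ Finset.range (k + 1), coalescence N μ K g h.measurable (j + 1) (fun x =>
        feynmanKac g K (j + 1) (k + 2 - (j + 1)) (fun _ => 1) x *
          feynmanKac g K (j + 1) (k + 2 - (j + 1)) F x) ≤ 2 * D * norm32 (μ (k + 2)) F := by
      intro j hj
      have hj' : j < k + 1 := Finset.mem_range.1 hj
      have := h.isProb (j + 1) (by omega) (by omega)
      have hm : Measurable fun x => feynmanKac g K (j + 1) (k + 2 - (j + 1)) (fun _ => 1) x *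
          feynmanKac g K (j + 1) (k + 2 - (j + 1)) F x :=
        (measurable_feynmanKac h.measurable K measurable_const _ _).mul
          (measurable_feynmanKac h.measurable K hF _ _)
      have h2 := hD F hF (j + 1) (k + 2 - (j + 1)) (by omega) (by omega) (by omega)
      rw [show j + 1 + (k + 2 - (j + 1)) = k + 2 by omega] at h2
      refine (ih (j + 1) (by omega) (by omega) (by omega) hm).trans ?_
      calc _ ≤ norm32 (μ (j + 1)) (fun x => feynmanKac g K (j + 1) (k + 2 - (j + 1)) (fun _ => 1) x *
              feynmanKac g K (j + 1) (k + 2 - (j + 1)) F x) + 1 *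
              norm32 (μ (j + 1)) (fun x => feynmanKac g K (j + 1) (k + 2 - (j + 1)) (fun _ => 1) x *
              feynmanKac g K (j + 1) (k + 2 - (j + 1)) F x) :=
            add_le_add (lintegral_le_norm32 hm) (mul_le_mul_left hcoef _)
        _ ≤ D * norm32 (μ (k + 2)) F + 1 * (D * norm32 (μ (k + 2)) F) := by gcongr
        _ = _ := by ring
    refine h1.trans (add_le_add (le_of_eq (by simp)) ?_)
    rw [ENNReal.mul_div_right_comm.symm]
    refine ENNReal.div_le_div_right ((Finset.sum_le_sum hterm).trans ?_) _
    rw [Finset.sum_const, Finset.card_range, nsmul_eq_mul]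
    have : ((k + 1 : ℕ) : ℝ≥0∞) ≤ n := Nat.cast_le.2 (by omega)
    calc ((k + 1 : ℕ) : ℝ≥0∞) * (2 * D * norm32 (μ (k + 2)) F)
        ≤ n * (2 * D * norm32 (μ (k + 2)) F) := by gcongr
      _ = _ := by ring

/-- With the stated number of particles the normalizing constant has variance at most `ε²`. -/
theorem lintegral_sq_weightedLaw_le [NeZero N] (h : SmoothingLevels n μ g K W γ) (hn : 1 ≤ n)
    {δ : ℝ≥0∞}
    (hN1 : 128 * n * (ENNReal.ofReal γ ^ (35 / 8 : ℝ) * W ^ (15 / 8 : ℝ)) ≤ N)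
    (hN2 : 16 * n * (ENNReal.ofReal γ * W) ≤ δ * N) :
    ∫⁻ p, p.1 ^ 2 ∂(weightedLaw N μ K g h.measurable n) ≤ 1 + δ := by
  have hprob := h.isProb n hn le_rfl
  have hΓ := h.one_le_ofReal
  have hW := h.one_le_mass
  set Γ := ENNReal.ofReal γ with hΓdef
  set D : ℝ≥0∞ := 2 ^ (1 / 2 : ℝ) * Γ ^ (17 / 6 : ℝ) * W ^ (4 / 3 : ℝ) with hDdef
  set X := Γ ^ (35 / 8 : ℝ) * W ^ (15 / 8 : ℝ) with hX
  have hsqrt : (2 : ℝ≥0∞) ^ (1 / 2 : ℝ) ≤ 2 := by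
    conv_rhs => rw [← ENNReal.rpow_one 2]
    exact ENNReal.rpow_le_rpow_of_exponent_le (by norm_num) (by norm_num)
  have hD1 : D ≤ 2 * X := by
    rw [hDdef, hX, ← mul_assoc]
    refine mul_le_mul' (mul_le_mul' hsqrt ?_) ?_
    · exact ENNReal.rpow_le_rpow_of_exponent_le hΓ (by norm_num)
    · exact ENNReal.rpow_le_rpow_of_exponent_le hW (by norm_num)
  have hDN : 2 * n * D ≤ N := by
    calc 2 * n * D ≤ 2 * n * (2 * X) := by gcongr
      _ = 4 * n * X := by ring
      _ ≤ 128 * n * X := by gcongr; norm_num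
      _ ≤ N := hN1
  -- The second-order contribution is absorbed by the first-order one.
  have hDB : 2 * n * D / N * (2 * Γ ^ (7 / 3 : ℝ) * W ^ (4 / 3 : ℝ)) ≤ Γ * W := by
    rw [ENNReal.mul_div_right_comm.symm]
    refine ENNReal.div_le_of_le_mul ?_
    have h1 : Γ ^ (17 / 6 : ℝ) * Γ ^ (7 / 3 : ℝ) ≤ Γ ^ (35 / 8 : ℝ) * Γ := by
      conv_rhs => rw [← ENNReal.rpow_one Γ, ← ENNReal.rpow_mul, ← ENNReal.rpow_add_of_nonneg _ _
        (by norm_num) (by norm_num)]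
      rw [← ENNReal.rpow_add_of_nonneg _ _ (by norm_num) (by norm_num)]
      exact ENNReal.rpow_le_rpow_of_exponent_le hΓ (by norm_num)
    have h2 : W ^ (4 / 3 : ℝ) * W ^ (4 / 3 : ℝ) ≤ W ^ (15 / 8 : ℝ) * W := by
      conv_rhs => rw [← ENNReal.rpow_one W, ← ENNReal.rpow_mul, ← ENNReal.rpow_add_of_nonneg _ _
        (by norm_num) (by norm_num)]
      rw [← ENNReal.rpow_add_of_nonneg _ _ (by norm_num) (by norm_num)]
      exact ENNReal.rpow_le_rpow_of_exponent_le hW (by norm_num)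
    calc 2 * n * D * (2 * Γ ^ (7 / 3 : ℝ) * W ^ (4 / 3 : ℝ))
        = 4 * n * 2 ^ (1 / 2 : ℝ) * (Γ ^ (17 / 6 : ℝ) * Γ ^ (7 / 3 : ℝ)) *
            (W ^ (4 / 3 : ℝ) * W ^ (4 / 3 : ℝ)) := by rw [hDdef]; ring
      _ ≤ 4 * n * 2 * (Γ ^ (35 / 8 : ℝ) * Γ) * (W ^ (15 / 8 : ℝ) * W) := by gcongr
      _ = Γ * W * (8 * n * X) := by rw [hX]; ring
      _ ≤ Γ * W * (128 * n * X) := by gcongr; norm_num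
      _ ≤ Γ * W * N := by gcongr
  have hone := fun k => measurable_feynmanKac h.measurable K (measurable_const (a := (1 : ℝ≥0∞)))
    (k + 1) (n - (k + 1))
  have hterm : ∀ j ∈ Finset.range n, coalescence N μ K g h.measurable (j + 1) (fun x =>
      feynmanKac g K (j + 1) (n - (j + 1)) (fun _ => 1) x *
        feynmanKac g K (j + 1) (n - (j + 1)) (fun _ => 1) x) ≤ 3 * (Γ * W) := by
    intro j hj
    have hj' : j < n := Finset.mem_range.1 hj
    refine (h.coalescence_le (fun f hf j d => h.norm32_feynmanKac_mul_le hf) hDN (by omega)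
      (by omega) ((hone j).mul (hone j))).trans ?_
    have h1 := h.lintegral_feynmanKac_one_sq_le (j := j + 1) (d := n - (j + 1)) (by omega)
      (by omega)
    have h2 := h.norm32_feynmanKac_one_sq_le (j := j + 1) (d := n - (j + 1)) (by omega) (by omega)
    simp only [ENNReal.rpow_two, sq] at h1
    calc _ ≤ 2 * Γ * W + 2 * n * D / N * (2 * Γ ^ (7 / 3 : ℝ) * W ^ (4 / 3 : ℝ)) :=
          add_le_add h1 (mul_le_mul_right h2 _)
      _ ≤ 2 * Γ * W + Γ * W := by gcongr
      _ = 3 * (Γ * W) := by ring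
  have hmain := h.secondMoment_le (N := N) le_rfl (measurable_const (a := (1 : ℝ≥0∞)))
    (measurable_const (a := (1 : ℝ≥0∞))) hn le_rfl
  have hN0 : (N : ℝ≥0∞) ≠ 0 := by exact_mod_cast NeZero.ne N
  have hemp : ∀ ξ : Fin N → E, empMean (fun _ => 1) ξ = 1 := fun ξ => by
    simp [empMean, ENNReal.div_self hN0]
  simp only [tsub_self, feynmanKac, secondMoment, hemp, mul_one, lintegral_const, measure_univ]
    at hmain
  refine hmain.trans (add_le_add le_rfl (ENNReal.div_le_of_le_mul ?_))
  refine (Finset.sum_le_sum hterm).trans ?_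
  rw [Finset.sum_const, Finset.card_range, nsmul_eq_mul]
  refine le_trans ?_ hN2
  calc (n : ℝ≥0∞) * (3 * (Γ * W)) = 3 * n * (Γ * W) := by ring
    _ ≤ 16 * n * (Γ * W) := by gcongr; norm_num

end SmoothingLevels

/-! ### The bias of a particle -/

theorem isProbabilityMeasure_weightedLaw {N : ℕ} [NeZero N] {μ : ℕ → Measure E}
    {K : ℕ → Kernel E E} [∀ k, IsMarkovKernel (K k)] {g : ℕ → E → ℝ≥0}
    {hg : ∀ k, Measurable (g k)} [IsProbabilityMeasure (μ 1)] {k : ℕ} (hk : 1 ≤ k) :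
    IsProbabilityMeasure (weightedLaw N μ K g hg k) := by
  induction k, hk using Nat.le_induction with
  | base => exact Measure.isProbabilityMeasure_map measurable_prodMk_left.aemeasurable
  | succ k hk ih =>
    obtain ⟨k, rfl⟩ : ∃ k', k = k' + 1 := ⟨k - 1, by omega⟩
    have := isMarkovKernel_particleKernel (N := N) (g (k + 1)) (hg (k + 1)) (K (k + 2))
    rw [weightedLaw]
    infer_instance

theorem lintegral_weightedLaw_snd {N : ℕ} [NeZero N] {μ : ℕ → Measure E}
    {P : ℕ → MarkovSemigroup E} {t : ℕ → ℝ≥0} {g : ℕ → E → ℝ≥0} {hg : ∀ k, Measurable (g k)}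
    {k : ℕ} (hk : 1 ≤ k) {F : (Fin N → E) → ℝ≥0∞} (hF : Measurable F) :
    ∫⁻ p, F p.2 ∂(weightedLaw N μ (fun k => (P k).kernel (t k)) g hg k)
      = ∫⁻ ξ, F ξ ∂(particleLaw N μ P t g hg k) := by
  induction k, hk using Nat.le_induction generalizing F with
  | base =>
    rw [lintegral_weightedLaw_one (F := fun p => F p.2) (hF.comp measurable_snd)]
    rfl
  | succ k hk ih =>
    obtain ⟨k, rfl⟩ : ∃ k', k = k' + 1 := ⟨k - 1, by omega⟩
    rw [lintegral_weightedLaw_succ (F := fun p => F p.2) (hF.comp measurable_snd)]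
    have hm : Measurable fun ξ => ∫⁻ ζ, F ζ
        ∂(particleKernel N (g (k + 1)) (hg (k + 1)) ((P (k + 2)).kernel (t (k + 2))) ξ) :=
      hF.lintegral_kernel
    rw [ih hm, particleLaw, Measure.lintegral_bind (Kernel.aemeasurable _) hF.aemeasurable,
      Measure.lintegral_bind (Kernel.aemeasurable _) hF.lintegral_kernel.aemeasurable]
    refine lintegral_congr fun ξ => ?_
    rw [particleKernel, Kernel.lintegral_comp _ _ _ hF]

/-- Reweighting a probability measure by a density of mean one and second moment at most
`1 + ε²` changes the probability of an event by at most `ε`. -/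
theorem abs_measureReal_sub_le {Ω : Type*} [MeasurableSpace Ω] {J : Measure Ω}
    [IsProbabilityMeasure J] {φ : Ω → ℝ≥0∞} (hφ : Measurable φ) (h1 : ∫⁻ ω, φ ω ∂J = 1) {ε : ℝ}
    (hε : 0 ≤ ε) (h2 : ∫⁻ ω, φ ω ^ 2 ∂J ≤ 1 + ENNReal.ofReal (ε ^ 2)) {B : Set Ω}
    (hB : MeasurableSet B) :
    |J.real B - (∫⁻ ω, φ ω * B.indicator 1 ω ∂J).toReal| ≤ ε := by
  set X : Ω → ℝ := fun ω => (φ ω).toReal with hX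
  have hXm : Measurable X := hφ.ennreal_toReal
  have hfin : ∀ᵐ ω ∂J, φ ω < ∞ := ae_lt_top hφ (by rw [h1]; exact ENNReal.one_ne_top)
  have hXeq : ∀ᵐ ω ∂J, ENNReal.ofReal (X ω) = φ ω := by
    filter_upwards [hfin] with ω hω using ENNReal.ofReal_toReal hω.ne
  have hsq : ∫⁻ ω, ENNReal.ofReal (X ω ^ 2) ∂J = ∫⁻ ω, φ ω ^ 2 ∂J := by
    refine lintegral_congr_ae ?_
    filter_upwards [hXeq] with ω hω
    rw [ENNReal.ofReal_pow ENNReal.toReal_nonneg, hω]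
  have hsqfin : ∫⁻ ω, φ ω ^ 2 ∂J ≠ ∞ :=
    ne_top_of_le_ne_top (by finiteness) h2
  have hX2i : Integrable (fun ω => X ω ^ 2) J := by
    refine ⟨(hXm.pow_const 2).aestronglyMeasurable, ?_⟩
    rw [hasFiniteIntegral_iff_ofReal (ae_of_all _ fun ω => sq_nonneg _), hsq]
    exact hsqfin.lt_top
  have hXL : MemLp X 2 J := (memLp_two_iff_integrable_sq hXm.aestronglyMeasurable).2 hX2i
  have hXi : Integrable X J := hXL.integrable (by norm_num)
  have hEX : ∫ ω, X ω ∂J = 1 := by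
    rw [integral_eq_lintegral_of_nonneg_ae (ae_of_all _ fun ω => ENNReal.toReal_nonneg)
      hXm.aestronglyMeasurable, lintegral_congr_ae hXeq, h1, ENNReal.toReal_one]
  have hEX2 : ∫ ω, X ω ^ 2 ∂J ≤ 1 + ε ^ 2 := by
    rw [integral_eq_lintegral_of_nonneg_ae (ae_of_all _ fun ω => sq_nonneg _)
      (hXm.pow_const 2).aestronglyMeasurable, hsq]
    have := ENNReal.toReal_mono (by finiteness) h2
    rwa [ENNReal.toReal_add ENNReal.one_ne_top ENNReal.ofReal_ne_top, ENNReal.toReal_one,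
      ENNReal.toReal_ofReal (sq_nonneg ε)] at this
  have hYi : Integrable (fun ω => 1 - X ω) J := (integrable_const 1).sub hXi
  have hYL : MemLp (fun ω => |1 - X ω|) 2 J := ((memLp_const 1).sub hXL).abs
  have hY2 : (∫ ω, |1 - X ω| ∂J) ^ 2 ≤ ε ^ 2 := by
    have hvar := variance_nonneg (fun ω => |1 - X ω|) J
    rw [variance_eq_sub hYL] at hvar
    have h3 : ∫ ω, ((fun ω => |1 - X ω|) ^ 2) ω ∂J = 1 - 2 * 1 + ∫ ω, X ω ^ 2 ∂J := by
      have h4 : ∀ ω, ((fun ω => |1 - X ω|) ^ 2) ω = (1 - 2 * X ω) + X ω ^ 2 := fun ω => by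
        simp only [Pi.pow_apply, sq_abs]; ring
      have h5 : Integrable (fun ω => 1 - 2 * X ω) J := (integrable_const 1).sub (hXi.const_mul 2)
      simp only [h4]
      rw [integral_add h5 hX2i, integral_sub (integrable_const 1) (hXi.const_mul 2),
        integral_const_mul, hEX]
      simp
    linarith
  have hL1 : ∫ ω, |1 - X ω| ∂J ≤ ε := le_of_abs_le (abs_le_of_sq_le_sq hY2 hε)
  have hreal : (∫⁻ ω, φ ω * B.indicator 1 ω ∂J).toReal = ∫ ω, B.indicator X ω ∂J := by
    rw [integral_eq_lintegral_of_nonneg_ae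
      (ae_of_all _ fun ω => Set.indicator_nonneg (fun _ _ => ENNReal.toReal_nonneg) ω)
      (hXm.indicator hB).aestronglyMeasurable]
    congr 1
    refine lintegral_congr_ae ?_
    filter_upwards [hXeq] with ω hω
    by_cases h : ω ∈ B
    · rw [Set.indicator_of_mem h, Set.indicator_of_mem h, hω, Pi.one_apply, mul_one]
    · rw [Set.indicator_of_notMem h, Set.indicator_of_notMem h, mul_zero, ENNReal.ofReal_zero]
  have h1B : Integrable (B.indicator (1 : Ω → ℝ)) J := (integrable_const (1 : ℝ)).indicator hB
  have hXB : Integrable (B.indicator X) J := hXi.indicator hB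
  rw [hreal, ← integral_indicator_one hB, ← integral_sub h1B hXB]
  refine (abs_integral_le_integral_abs.trans (integral_mono (h1B.sub hXB).abs hYi.abs
    fun ω => ?_)).trans hL1
  by_cases h : ω ∈ B <;> simp [h]

theorem tvDist_le {π ρ : Measure E} {ε : ℝ} (hε : 0 ≤ ε)
    (h : ∀ A, MeasurableSet A → |π.real A - ρ.real A| ≤ ε) : tvDist π ρ ≤ ε :=
  Real.iSup_le (fun A => h A.1 A.2) hε

/-- A particle of a smoothing system is within `ε` of its target in total variation as soon as the
normalizing constant has variance at most `ε²`. -/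
theorem SmoothingLevels.tvDist_marginalLaw_le {N n : ℕ} {μ : ℕ → Measure E}
    {P : ℕ → MarkovSemigroup E} {t : ℕ → ℝ≥0} {g : ℕ → E → ℝ≥0} {W : ℝ≥0∞} {γ : ℝ}
    (h : SmoothingLevels n μ g (fun k => (P k).kernel (t k)) W γ) (hn : 1 ≤ n) {ε : ℝ}
    (hε : 0 ≤ ε)
    (hN1 : 128 * n * (ENNReal.ofReal γ ^ (35 / 8 : ℝ) * W ^ (15 / 8 : ℝ)) ≤ N)
    (hN2 : 16 * n * (ENNReal.ofReal γ * W) ≤ ENNReal.ofReal (ε ^ 2) * N) (i : Fin N) :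
    tvDist (marginalLaw N μ P t g h.measurable n i) (μ n) ≤ ε := by
  have : NeZero N := ⟨fun h0 => by subst h0; exact i.elim0⟩
  have hprob := h.isProb 1 le_rfl hn
  have hprobn := h.isProb n hn le_rfl
  set J := weightedLaw N μ (fun k => (P k).kernel (t k)) g h.measurable n with hJ
  have hJprob : IsProbabilityMeasure J := isProbabilityMeasure_weightedLaw hn
  have hstep : ∀ j, 1 ≤ j → j < n → ∀ f : E → ℝ≥0∞, Measurable f →
      ∫⁻ x, g j x * lact ((P (j + 1)).kernel (t (j + 1))) f x ∂(μ j) = ∫⁻ x, f x ∂(μ (j + 1)) :=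
    fun j hj hjn f hf => by
      rw [h.lintegral_mul hj hjn (measurable_lact _ hf), (h.smoothing j hj hjn).lintegral_lact f hf]
  have heval : ∀ {f : E → ℝ≥0∞}, Measurable f →
      ∫⁻ p, p.1 * f (p.2 i) ∂J = ∫⁻ x, f x ∂(μ n) := fun hf =>
    lintegral_weightedLaw_eval hstep hn hf i
  have hφ1 : ∫⁻ p, p.1 ∂J = 1 := by
    have h1 := heval (measurable_const (a := (1 : ℝ≥0∞)))
    simpa using h1
  have hφ2 := h.lintegral_sq_weightedLaw_le (N := N) hn hN1 hN2
  refine tvDist_le hε fun A hA => ?_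
  set B : Set (ℝ≥0∞ × (Fin N → E)) := {p | p.2 i ∈ A} with hB
  have hBm : MeasurableSet B := ((measurable_pi_apply i).comp measurable_snd) hA
  have h1 := abs_measureReal_sub_le measurable_fst hφ1 hε hφ2 hBm
  have hmarg : (marginalLaw N μ P t g h.measurable n i).real A = J.real B := by
    have hS : MeasurableSet {ξ : Fin N → E | ξ i ∈ A} := measurable_pi_apply i hA
    have h2 := lintegral_weightedLaw_snd (N := N) (μ := μ) (P := P) (t := t) (g := g)
      (hg := h.measurable) hn (F := {ξ : Fin N → E | ξ i ∈ A}.indicator 1)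
      (measurable_one.indicator hS)
    rw [lintegral_indicator_one hS] at h2
    rw [measureReal_def, measureReal_def, marginalLaw, Measure.map_apply (measurable_pi_apply i) hA,
      ← lintegral_indicator_one hBm]
    exact congrArg ENNReal.toReal h2.symm
  have htarget : (∫⁻ p, p.1 * B.indicator 1 p ∂J).toReal = (μ n).real A := by
    have h2 := heval (measurable_one.indicator hA)
    rw [lintegral_indicator_one hA] at h2
    rw [measureReal_def, ← h2]
    rfl
  rwa [hmarg, ← htarget]

end SMC

end

theorem mainTheorem2 {E : Type*} [MeasurableSpace E] (n N : ℕ) (hn : 1 ≤ n)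
    (μ : ℕ → Measure E) (P : ℕ → SMC.MarkovSemigroup E) (t : ℕ → ℝ≥0)
    (m : ℕ → ℕ) (w : ∀ k, Fin (m k) → ℝ) (ν : ∀ k, Fin (m k) → Measure E)
    (Q : ∀ k, Fin (m k) → SMC.MarkovSemigroup E) (c : ∀ k, Fin (m k) → ℝ)
    (g : ℕ → E → ℝ≥0) (hg : ∀ k, Measurable (g k)) (γ : ℝ)
    (hA : SMC.Assumption n μ P w ν Q c g γ)
    (M : ℕ) (hM : IsGreatest {a | ∃ k, 1 ≤ k ∧ k ≤ n ∧ a = m k} M)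
    (wmin : ℝ) (hwmin : IsLeast {a | ∃ k, 1 ≤ k ∧ k ≤ n ∧ ∃ i, a = w k i} wmin)
    (C : ℕ → ℝ) (hC : ∀ k, 1 ≤ k → k ≤ n → IsGreatest (Set.range (c k)) (C k))
    (ε : ℝ) (hε : 0 < ε)
    (hN : (n : ℝ) * max (16 * γ * M / (wmin * ε ^ 2))
      (128 * γ ^ (35 / 8 : ℝ) * (M : ℝ) ^ (7 / 4 : ℝ) / wmin ^ (15 / 8 : ℝ)) ≤ N)
    (ht : ∀ k, 1 ≤ k → k ≤ n → 2 * C k * γ ^ 7 ≤ t k) :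
    ∀ i : Fin N, SMC.tvDist (SMC.marginalLaw N μ P t g hg n i) (μ n) ≤ ε := by
  intro i
  have hprob : ∀ k, 1 ≤ k → k ≤ n → IsProbabilityMeasure (μ k) := fun k h1 h2 =>
    (hA.level k h1 h2).stationary.isProb
  rcases Nat.eq_or_lt_of_le hn with rfl | hn2
  · -- With a single level the particles are exact samples.
    have := hprob 1 le_rfl le_rfl
    have h1 : SMC.marginalLaw N μ P t g hg 1 i = μ 1 :=
      (measurePreserving_eval (fun _ : Fin N => μ 1) i).map_eq
    refine SMC.tvDist_le hε.le fun A _ => ?_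
    rw [h1, sub_self, abs_zero]
    exact hε.le
  -- A density with respect to a probability measure cannot be bounded by less than one.
  have hγ : 1 ≤ γ := by
    have := hprob 1 le_rfl hn
    have := hprob 2 (by norm_num) hn2
    have h1 : μ 2 Set.univ = ∫⁻ x, (g 1 x : ℝ≥0∞) ∂(μ 1) := by
      rw [hA.density 1 le_rfl hn2, withDensity_apply _ MeasurableSet.univ, Measure.restrict_univ]
    have h2 : ∫⁻ x, (g 1 x : ℝ≥0∞) ∂(μ 1) ≤ ∫⁻ _, ENNReal.ofReal γ ∂(μ 1) := by
      refine lintegral_mono_ae ?_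
      filter_upwards [hA.density_le 1 le_rfl hn2] with x hx
      rw [← ENNReal.ofReal_coe_nnreal]
      exact ENNReal.ofReal_le_ofReal hx
    rw [← h1, measure_univ, lintegral_const, measure_univ, mul_one] at h2
    simpa using h2
  obtain ⟨k₀, hk₀, hk₀n, i₀, hw₀⟩ := hwmin.1
  have hwpos : 0 < wmin := hw₀ ▸ (hA.level k₀ hk₀ hk₀n).weight_pos i₀
  have hw1 : wmin ≤ 1 := by
    rw [hw₀, ← (hA.level k₀ hk₀ hk₀n).weight_sum]
    exact Finset.single_le_sum (f := w k₀)
      (fun j _ => ((hA.level k₀ hk₀ hk₀n).weight_pos j).le) (Finset.mem_univ i₀)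
  have hM1 : (1 : ℝ) ≤ M := by
    have h1 : m k₀ ≤ M := hM.2 ⟨k₀, hk₀, hk₀n, rfl⟩
    have h2 := i₀.pos
    exact_mod_cast h2.trans_le h1
  have hsys : SMC.SmoothingLevels n μ g (fun k => (P k).kernel (t k))
      (ENNReal.ofReal wmin⁻¹) γ :=
    { measurable := hg
      one_le_bound := hγ
      one_le_mass := by
        rw [← ENNReal.ofReal_one]
        exact ENNReal.ofReal_le_ofReal ((one_le_inv₀ hwpos).2 hw1)
      isProb := hprob
      density := hA.density
      density_le := hA.density_le
      smoothing := fun k hk hkn =>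
        (hA.level (k + 1) (by omega) hkn).isSmoothing
          (fun i => (hC (k + 1) (by omega) hkn).2 ⟨i, rfl⟩) hwpos
          (fun i => hwmin.2 ⟨k + 1, by omega, hkn, i, rfl⟩) hγ (ht (k + 1) (by omega) hkn) }
  have hn0 : (0 : ℝ) ≤ n := n.cast_nonneg
  have hinv : 0 < wmin⁻¹ := inv_pos.2 hwpos
  have hN1 : 128 * (n : ℝ) * (γ ^ (35 / 8 : ℝ) * wmin⁻¹ ^ (15 / 8 : ℝ)) ≤ N := by
    refine le_trans ?_ ((mul_le_mul_of_nonneg_left (le_max_right _ _) hn0).trans hN)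
    have h1 : (1 : ℝ) ≤ (M : ℝ) ^ (7 / 4 : ℝ) := Real.one_le_rpow hM1 (by norm_num)
    have h2 : 0 ≤ 128 * (n : ℝ) * (γ ^ (35 / 8 : ℝ) * wmin⁻¹ ^ (15 / 8 : ℝ)) := by positivity
    refine (le_mul_of_one_le_right h2 h1).trans (le_of_eq ?_)
    rw [Real.inv_rpow hwpos.le]
    ring
  have hN2 : 16 * (n : ℝ) * (γ * wmin⁻¹) ≤ ε ^ 2 * N := by
    have h1 := (mul_le_mul_of_nonneg_left (le_max_left _ _) hn0).trans hN
    have h2 := mul_le_mul_of_nonneg_left h1 (sq_nonneg ε)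
    refine le_trans ?_ h2
    have h3 : 0 ≤ 16 * (n : ℝ) * (γ * wmin⁻¹) := by positivity
    refine (le_mul_of_one_le_right h3 hM1).trans (le_of_eq ?_)
    field_simp
  refine hsys.tvDist_marginalLaw_le hn hε.le ?_ ?_ i
  · have h1 := ENNReal.ofReal_le_ofReal hN1
    rw [ENNReal.ofReal_mul (by positivity), ENNReal.ofReal_mul (by norm_num),
      ENNReal.ofReal_mul (by positivity), ← ENNReal.ofReal_rpow_of_pos (by linarith),
      ← ENNReal.ofReal_rpow_of_pos hinv] at h1
    simpa using h1
  · have h1 := ENNReal.ofReal_le_ofReal hN2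
    rw [ENNReal.ofReal_mul (by positivity), ENNReal.ofReal_mul (by norm_num),
      ENNReal.ofReal_mul (by linarith), ENNReal.ofReal_mul (sq_nonneg ε)] at h1
    simpa using h1
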